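/- Let $q\ge 2$, $n\ge 1$, $t\ge 1$ be integers. For $x=(x_1,\dots,x_n)\in\{0,1,\dots,q-1\}^n$, a transposition at location $k\in\{1,\dots,n-1\}$ swaps the consecutive symbols $x_k$ and $x_{k+1}$. Let $B(x;t)$ be the set of all strings obtained from $x$ by simultaneously performing transpositions at locations $k_1<\dots<k_s$ for some $0\le s\le t$, where $k_{j+1}\ge k_j+2$ for all $j$ (so the swapped pairs are disjoint). A nonempty set $\mathcal C\subseteq\{0,\dots,q-1\}^n$ corrects $t$ transpositions if $B(x;t)\cap B(x';t)=\emptyset$ for all distinct $x,x'\in\mathcal C$, and $M^\star_q(n;t)$ denotes the maximum cardinality of such a set. For nonnegative sequences write $a_n\lesssim b_n$ if $\limsup_{n\to\infty} a_n/b_n\le 1$. **Theorem.** For any fixed integers $q\ge 2$ and $t\ge 1$, as $n\to\infty$, $$\frac{(2t)!\,q^n}{(4t/3+1)\,n^{2t}}\;\lesssim\; M^\star_q(n;t)\;\lesssim\;\frac{t!\,q^{n+t}}{(q-1)^t\,n^t}.$$ In the binary case $q=2$, one moreover has $$c_t\,\frac{2^{n+t}}{n^t}\;\lesssim\; M^\star_2(n;t),$$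 where $c_1=\tfrac12$, $c_2=\tfrac13$, and $c_t=\tfrac1{2t+1}$ for $t\ge 3$. -/

import Mathlib

namespace TranspositionCodes

/-- A set of transposition locations in a string of length `n` with symbols indexed
`0, …, n - 1`: location `k` swaps the symbols at positions `k` and `k + 1`, and distinct
locations are at least `2` apart, so that the swapped pairs are disjoint. -/
def IsPattern (n : ℕ) (K : Finset ℕ) : Prop :=
  (∀ k ∈ K, k + 1 < n) ∧ ∀ j ∈ K, ∀ k ∈ K, j < k → j + 2 ≤ k

/-- `y` is the string obtained from `x` by simultaneously performing the transpositions
at the locations in `K`. -/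
def IsTransposed {n q : ℕ} (K : Finset ℕ) (x y : Fin n → Fin q) : Prop :=
  (∀ k ∈ K, ∀ h : k + 1 < n,
      y ⟨k, Nat.lt_of_succ_lt h⟩ = x ⟨k + 1, h⟩ ∧
      y ⟨k + 1, h⟩ = x ⟨k, Nat.lt_of_succ_lt h⟩) ∧
  ∀ i : Fin n, (∀ k ∈ K, (i : ℕ) ≠ k ∧ (i : ℕ) ≠ k + 1) → y i = x i

/-- `B(x; t)`: the strings obtainable from `x` by at most `t` simultaneous transpositions
of pairwise disjoint pairs of consecutive symbols. -/
def outputs {n q : ℕ} (x : Fin n → Fin q) (t : ℕ) : Set (Fin n → Fin q) :=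
  {y | ∃ K : Finset ℕ, IsPattern n K ∧ K.card ≤ t ∧ IsTransposed K x y}

/-- The code `C` corrects `t` transpositions. -/
def Corrects {n q : ℕ} (C : Finset (Fin n → Fin q)) (t : ℕ) : Prop :=
  ∀ x ∈ C, ∀ x' ∈ C, x ≠ x' → outputs x t ∩ outputs x' t = ∅

open Classical in
/-- The maximum cardinality of a (nonempty) code of length `n` over the alphabet
`{0, …, q - 1}` that corrects `t` transpositions. -/
noncomputable def maxCodeSize (q n t : ℕ) : ℕ :=
  ((Finset.univ : Finset (Finset (Fin n → Fin q))).filter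
    (fun C => C.Nonempty ∧ Corrects C t)).sup Finset.card

/-- `a_n ≲ b_n`, i.e. `limsup a_n / b_n ≤ 1`. The upper limit is taken in the extended reals. -/
def AsympLE (a b : ℕ → ℝ) : Prop :=
  Filter.limsup (fun n => ((a n / b n : ℝ) : EReal)) Filter.atTop ≤ 1

/-- The constant `c_t` in the binary lower bound (used for `t ≥ 1`). -/
noncomputable def binaryConst (t : ℕ) : ℝ :=
  if t = 1 then 1 / 2 else if t = 2 then 1 / 3 else 1 / (2 * (t : ℝ) + 1)

end TranspositionCodes

/-! Performing a pattern of disjoint transpositions is an involution, so codewords `x`, `x'` sharing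
an output `y` are both obtained from `y` by patterns of at most `t` locations. All three bounds
build on this.

General lower bound (Gilbert-Varshamov). A maximum code cannot be enlarged, so the confusable sets
of its words cover the whole space (`pow_le_maxCodeSize_mul`). A confusable string is reached by two
patterns in succession. If these contain no neighbouring locations, they compose to one pattern of
at most `2t` locations (`IsPattern.transpose_transpose_eq`). Neighbouring pairs number only
O(n^(2t-1)), so a confusable set has size at most (1+o(1)) n^(2t)/(2t)!, well within the factor
4t/3+1 allowed.

Upper bound (packing). Patterns supported on the `r` breaks of `x` give pairwise distinct outputs,
at least (r-3t)^t/t! of them (`card_mul_pow_le`), and outputs of distinct codewords are disjoint. By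
a Chernoff bound (`card_filter_breaks_lt_le`) all but exponentially few strings have about n(q-1)/q
breaks.

Binary lower bound. A transposition at `k` alters a single prefix count of ones, by at most one. The
syndrome, which adds b_0, ..., b_(r-1) for each prefix count r, therefore changes by ±b_r or not at
all, where r is the number of ones before `k` (`IsPattern.syndrome_transpose`). If signed sums of at
most `t` of the b_r are distinct, each syndrome class corrects `t` errors (`corrects_of_syndrome`),
and pigeonhole over the group gives a large code. Only indices below the weight occur, so after
discarding heavy strings about n/2 elements suffice; this is the source of the factor 2^t. The
groups are ℤ/(2p+1) for t = 1, ℤ/3 × (ℤ/p)² for t = 2, and ℤ/(2t+1) times the units of the field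
with p^t elements (Bose-Chowla) for t ≥ 3.

The case t = 2 needs p ≡ 2 mod 3, and every case here takes a prime p in that class just above n/2.
Such primes come from a one-sided Wiener-Ikehara argument (`PrimeGap.eventually_le_sum_div`). -/

namespace PrimeGap

open MeasureTheory Filter Topology

/-! ### A test function whose Fourier transform has nonpositive tails -/

/-- A compactly supported even bump with a positive slope at `0+`, which makes its Fourier
transform nonpositive outside a compact interval. -/
noncomputable def bump (τ : ℝ) : ℝ := (max 0 (1 - |τ|)) ^ 2 * (1 + 3 * |τ|)

/-- The Fourier transform of `bump`. -/
noncomputable def bumpHat (v : ℝ) : ℝ := ∫ τ, bump τ * Real.cos (2 * Real.pi * v * τ)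

lemma continuous_bump : Continuous bump := by
  unfold bump; fun_prop

lemma bump_neg (τ : ℝ) : bump (-τ) = bump τ := by simp [bump]

lemma bump_eq_zero {τ : ℝ} (h : 1 ≤ |τ|) : bump τ = 0 := by
  simp [bump, max_eq_left (sub_nonpos.2 h)]

lemma bump_nonneg (τ : ℝ) : 0 ≤ bump τ := by unfold bump; positivity

lemma hasCompactSupport_bump : HasCompactSupport bump :=
  HasCompactSupport.intro (isCompact_Icc (a := (-1 : ℝ)) (b := 1)) fun τ hτ => by
    refine bump_eq_zero ?_
    by_contra h
    exact hτ (abs_le.1 (not_le.1 h).le)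

lemma integrable_bump : Integrable bump :=
  continuous_bump.integrable_of_hasCompactSupport hasCompactSupport_bump

lemma integral_bump_mul_cos (w : ℝ) :
    ∫ τ, bump τ * Real.cos (w * τ) =
      2 * ∫ τ in (0 : ℝ)..1, (1 - τ) ^ 2 * (1 + 3 * τ) * Real.cos (w * τ) := by
  have h1 : ∀ τ, bump τ * Real.cos (w * τ) =
      (fun t => (max 0 (1 - t)) ^ 2 * (1 + 3 * t) * Real.cos (w * t)) |τ| := by
    intro τ
    have : Real.cos (w * |τ|) = Real.cos (w * τ) := by
      rcases abs_choice τ with h | h <;> rw [h]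
      rw [mul_neg, Real.cos_neg]
    simp [bump, this]
  simp_rw [h1]
  rw [integral_comp_abs (f := fun t => (max 0 (1 - t)) ^ 2 * (1 + 3 * t) * Real.cos (w * t)),
    intervalIntegral.integral_of_le zero_le_one]
  congr 1
  rw [setIntegral_eq_of_subset_of_forall_sdiff_eq_zero (s := Set.Ioc 0 1)
    measurableSet_Ioi Set.Ioc_subset_Ioi_self]
  · refine setIntegral_congr_fun measurableSet_Ioc fun τ hτ => ?_
    simp only [max_eq_right (sub_nonneg.2 hτ.2)]
  · intro τ hτ
    have : 1 < τ := by
      by_contra h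
      exact hτ.2 ⟨hτ.1, not_lt.1 h⟩
    simp [max_eq_left (sub_nonpos.2 this.le)]

/-- Repeated integration by parts. The cubic has a double zero at 1 and slope 1 at 0; that slope
produces the leading term -1/w². -/
lemma integral_cubic_mul_cos {w : ℝ} (hw : w ≠ 0) :
    ∫ τ in (0 : ℝ)..1, (1 - τ) ^ 2 * (1 + 3 * τ) * Real.cos (w * τ) =
      -(1 + 8 * Real.sin w / w - 18 * (1 - Real.cos w) / w ^ 2) / w ^ 2 := by
  have key : ∀ τ ∈ Set.uIcc (0 : ℝ) 1, HasDerivAt (fun τ : ℝ =>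
      (1 - τ) ^ 2 * (1 + 3 * τ) * Real.sin (w * τ) / w
        + (1 - 10 * τ + 9 * τ ^ 2) * Real.cos (w * τ) / w ^ 2
        - (-10 + 18 * τ) * Real.sin (w * τ) / w ^ 3 - 18 * Real.cos (w * τ) / w ^ 4)
      ((1 - τ) ^ 2 * (1 + 3 * τ) * Real.cos (w * τ)) τ := by
    intro τ _
    have hi := hasDerivAt_id' τ
    have hl : HasDerivAt (fun τ : ℝ => w * τ) w τ := by simpa using hi.const_mul w
    have hs := hl.sin
    have hc := hl.cos
    have h1 := ((((hi.const_sub 1).pow 2).mul ((hi.const_mul 3).const_add 1)).mul hs).div_const w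
    have h2 := (((((hi.const_mul 10).const_sub 1).add ((hi.pow 2).const_mul 9))).mul hc).div_const
      (w ^ 2)
    have h3 := ((((hi.const_mul 18).const_add (-10))).mul hs).div_const (w ^ 3)
    have h4 := (hc.const_mul 18).div_const (w ^ 4)
    convert! ((h1.add h2).sub h3).sub h4 using 1
    simp only [Pi.mul_apply, Pi.pow_apply, Pi.add_apply]
    field_simp
    ring
  rw [intervalIntegral.integral_eq_sub_of_hasDerivAt key
    (Continuous.intervalIntegrable (by fun_prop) _ _)]
  simp only [mul_zero, mul_one, Real.sin_zero, Real.cos_zero]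
  field_simp
  ring

lemma bumpHat_eq {v : ℝ} (hv : v ≠ 0) :
    bumpHat v = -2 * (1 + 8 * Real.sin (2 * Real.pi * v) / (2 * Real.pi * v) -
      18 * (1 - Real.cos (2 * Real.pi * v)) / (2 * Real.pi * v) ^ 2) / (2 * Real.pi * v) ^ 2 := by
  have : 2 * Real.pi * v ≠ 0 := by positivity
  rw [bumpHat, integral_bump_mul_cos, integral_cubic_mul_cos this]
  ring

lemma fourier_bump (v : ℝ) : FourierTransform.fourier (fun τ => (bump τ : ℂ)) v = bumpHat v := by
  rw [Real.fourier_real_eq_integral_exp_smul]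
  have h1 : ∀ τ : ℝ, Complex.exp (↑(-2 * Real.pi * τ * v) * Complex.I) • (bump τ : ℂ) =
      ((bump τ * Real.cos (2 * Real.pi * v * τ) : ℝ) : ℂ) -
        ((bump τ * Real.sin (2 * Real.pi * v * τ) : ℝ) : ℂ) * Complex.I := by
    intro τ
    rw [Complex.exp_mul_I, ← Complex.ofReal_cos, ← Complex.ofReal_sin,
      show -2 * Real.pi * τ * v = -(2 * Real.pi * v * τ) by ring, Real.cos_neg, Real.sin_neg]
    push_cast
    simp only [smul_eq_mul]
    ring
  have hi1 : Integrable fun τ => bump τ * Real.cos (2 * Real.pi * v * τ) :=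
    Continuous.integrable_of_hasCompactSupport (by have := continuous_bump; fun_prop)
      hasCompactSupport_bump.mul_right
  have hi2 : Integrable fun τ => bump τ * Real.sin (2 * Real.pi * v * τ) :=
    Continuous.integrable_of_hasCompactSupport (by have := continuous_bump; fun_prop)
      hasCompactSupport_bump.mul_right
  simp_rw [h1]
  rw [integral_sub hi1.ofReal (hi2.ofReal.mul_const _), integral_mul_const]
  rw [integral_complex_ofReal, integral_complex_ofReal]
  have : ∫ τ, bump τ * Real.sin (2 * Real.pi * v * τ) = 0 := by
    have h := integral_neg_eq_self (fun τ => bump τ * Real.sin (2 * Real.pi * v * τ)) volume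
    simp only [bump_neg, mul_neg, Real.sin_neg, integral_neg] at h
    linarith
  rw [this]
  simp [bumpHat]

lemma continuous_bumpHat : Continuous bumpHat := by
  have h : Continuous (FourierTransform.fourier (fun τ => (bump τ : ℂ)) : ℝ → ℂ) :=
    VectorFourier.fourierIntegral_continuous Real.continuous_fourierChar continuous_inner
      integrable_bump.ofReal
  have h2 : bumpHat = fun v => (FourierTransform.fourier (fun τ => (bump τ : ℂ)) v).re := by
    ext v; rw [fourier_bump, Complex.ofReal_re]
  rw [h2]
  exact Complex.continuous_re.comp h

/-- With w = 2πv, |w| ≥ 18 makes each of the two oscillating corrections to the leading -2/w² at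
most half of it. -/
lemma bumpHat_nonpos {v : ℝ} (hv : 3 ≤ |v|) : bumpHat v ≤ 0 := by
  have hv0 : v ≠ 0 := by rintro rfl; norm_num at hv
  rw [bumpHat_eq hv0]
  set w := 2 * Real.pi * v with hw
  have hw18 : 18 ≤ |w| := by
    rw [hw, abs_mul, abs_of_pos (by positivity)]
    nlinarith [Real.pi_gt_three]
  have hwpos : 0 < w ^ 2 := by rw [← sq_abs]; positivity
  refine div_nonpos_of_nonpos_of_nonneg ?_ hwpos.le
  have h1 : -(1 / 2) ≤ 8 * Real.sin w / w := by
    have : |8 * Real.sin w / w| ≤ 1 / 2 := by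
      rw [abs_div, abs_mul, abs_of_pos (by norm_num : (0 : ℝ) < 8), div_le_iff₀ (by linarith)]
      nlinarith [Real.abs_sin_le_one w]
    exact (abs_le.1 this).1
  have h2 : 18 * (1 - Real.cos w) / w ^ 2 ≤ 1 / 2 := by
    rw [div_le_iff₀ hwpos, ← sq_abs]
    nlinarith [Real.neg_one_le_cos w]
  nlinarith

lemma abs_bumpHat_le (v : ℝ) : |bumpHat v| ≤ 8 := by
  have h0 : ∫ τ, bump τ ≤ 8 := by
    have h := integral_bump_mul_cos 0
    simp only [zero_mul, Real.cos_zero, mul_one] at h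
    rw [h]
    have : ∫ τ in (0 : ℝ)..1, (1 - τ) ^ 2 * (1 + 3 * τ) ≤ ∫ τ in (0 : ℝ)..1, (4 : ℝ) := by
      refine intervalIntegral.integral_mono_on zero_le_one
        (Continuous.intervalIntegrable (by fun_prop) _ _)
        (Continuous.intervalIntegrable (by fun_prop) _ _) fun τ hτ => ?_
      have : (1 - τ) ^ 2 ≤ 1 := by nlinarith [hτ.1, hτ.2]
      nlinarith [hτ.1, hτ.2, sq_nonneg (1 - τ)]
    simp at this ⊢
    linarith
  refine le_trans ?_ h0
  rw [bumpHat, ← Real.norm_eq_abs]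
  refine norm_integral_le_of_norm_le integrable_bump (Eventually.of_forall fun τ => ?_)
  rw [norm_mul, Real.norm_eq_abs, Real.norm_eq_abs, abs_of_nonneg (bump_nonneg τ)]
  exact mul_le_of_le_one_right (bump_nonneg τ) (Real.abs_cos_le_one _)

lemma abs_bumpHat_le_inv (v : ℝ) : |bumpHat v| ≤ 16 * (1 + v ^ 2)⁻¹ := by
  rw [← div_eq_mul_inv, le_div_iff₀ (by positivity)]
  rcases le_total |v| 1 with h | h
  · have : v ^ 2 ≤ 1 := by rw [← sq_abs]; nlinarith [abs_nonneg v]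
    nlinarith [abs_bumpHat_le v, abs_nonneg (bumpHat v), sq_nonneg v]
  · have hv0 : v ≠ 0 := by rintro rfl; norm_num at h
    have h1 : 1 ≤ v ^ 2 := by rw [← sq_abs]; nlinarith
    rw [bumpHat_eq hv0]
    set w := 2 * Real.pi * v with hw
    have hw6 : 6 * |v| ≤ |w| := by
      rw [hw, abs_mul, abs_of_pos (by positivity : 0 < 2 * Real.pi)]
      nlinarith [Real.pi_gt_three]
    have hwv : 36 * v ^ 2 ≤ w ^ 2 := by
      rw [← sq_abs v, ← sq_abs w]; nlinarith [abs_nonneg v]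
    have hwpos : 0 < w ^ 2 := by linarith
    have h2 : |8 * Real.sin w / w| ≤ 2 := by
      rw [abs_div, abs_mul, abs_of_pos (by norm_num : (0 : ℝ) < 8), div_le_iff₀ (by linarith)]
      nlinarith [Real.abs_sin_le_one w]
    have h3 : |18 * (1 - Real.cos w) / w ^ 2| ≤ 1 := by
      rw [abs_of_nonneg (by have := Real.cos_le_one w; positivity [sub_nonneg.2 this]),
        div_le_iff₀ hwpos]
      nlinarith [Real.neg_one_le_cos w]
    rw [abs_div, abs_of_pos hwpos, div_mul_eq_mul_div, div_le_iff₀ hwpos]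
    have h4 : |-2 * (1 + 8 * Real.sin w / w - 18 * (1 - Real.cos w) / w ^ 2)| ≤ 8 := by
      rw [abs_le] at *
      constructor <;> linarith [h2.1, h2.2, h3.1, h3.2]
    calc _ ≤ 8 * (1 + v ^ 2) := by gcongr
      _ ≤ _ := by linarith

lemma integrable_bumpHat : Integrable bumpHat :=
  (integrable_inv_one_add_sq.const_mul 16).mono' continuous_bumpHat.aestronglyMeasurable
    (Eventually.of_forall abs_bumpHat_le_inv)

/-- Fourier inversion at 0, where the bump equals 1. The positive total mass is what makes the pole
contribute positively. -/
lemma integral_bumpHat : ∫ v, bumpHat v = 1 := by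
  have hF : FourierTransform.fourier (fun τ => (bump τ : ℂ)) = fun v => (bumpHat v : ℂ) :=
    funext fourier_bump
  have hi : Integrable fun τ => (bump τ : ℂ) := integrable_bump.ofReal
  have hi' : Integrable fun v => (bumpHat v : ℂ) := integrable_bumpHat.ofReal
  have h2 := hi.fourierInv_fourier_eq (by rwa [hF]) (v := 0)
    (Complex.continuous_ofReal.comp continuous_bump).continuousAt
  rw [hF] at h2
  rw [Real.fourierInv_eq'] at h2
  simp only [inner_zero_right, mul_zero, Complex.ofReal_zero, zero_mul, Complex.exp_zero,
    one_smul] at h2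
  rw [integral_complex_ofReal] at h2
  have h3 := Complex.ofReal_injective h2
  simpa [bump] using h3

/-! ### A one-sided Wiener-Ikehara bound -/

lemma norm_exp_mul_I (x : ℝ) : ‖Complex.exp (x * Complex.I)‖ = 1 := Complex.norm_exp_ofReal_mul_I x

lemma integral_bump_mul_exp (v : ℝ) :
    ∫ τ, (bump τ : ℂ) * Complex.exp (((-2 * Real.pi * τ * v : ℝ) : ℂ) * Complex.I) = bumpHat v := by
  rw [← fourier_bump, Real.fourier_real_eq_integral_exp_smul]
  simp_rw [smul_eq_mul, mul_comm]

lemma integrable_bump_mul {f : ℝ → ℂ} (hf : Continuous f) :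
    Integrable fun τ => (bump τ : ℂ) * f τ := by
  refine Continuous.integrable_of_hasCompactSupport (by have := continuous_bump; fun_prop) ?_
  exact (hasCompactSupport_bump.comp_left (g := fun x : ℝ => (x : ℂ)) (by simp)).mul_right

lemma term_vertical (a : ℕ → ℝ) (ha : a 0 = 0) (σ y : ℝ) (n : ℕ) :
    LSeries.term (fun n => (a n : ℂ)) (σ + y * Complex.I) n =
      ((a n / (n : ℝ) ^ σ : ℝ) : ℂ) * Complex.exp (((-y * Real.log n : ℝ) : ℂ) * Complex.I) := by
  rcases eq_or_ne n 0 with rfl | hn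
  · simp [ha]
  · have hn' : (n : ℂ) ≠ 0 := by exact_mod_cast hn
    have hnpos : (0 : ℝ) < n := by positivity
    rw [LSeries.term_of_ne_zero hn, Complex.cpow_add _ _ hn', div_mul_eq_div_div]
    push_cast
    rw [Complex.ofReal_cpow hnpos.le, Complex.ofReal_natCast,
      div_eq_mul_inv _ ((n : ℂ) ^ ((y : ℂ) * Complex.I))]
    congr 1
    rw [Complex.cpow_def_of_ne_zero hn', ← Complex.exp_neg]
    congr 1
    ring

/-- The smoothed sum of the coefficients near `exp L` as an integral of the Dirichlet series over a
vertical segment. -/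
lemma tsum_mul_bumpHat (a : ℕ → ℝ) (ha : a 0 = 0) {σ : ℝ}
    (hs : LSeriesSummable (fun n => (a n : ℂ)) σ) (R L : ℝ) :
    ((∑' n : ℕ, a n / (n : ℝ) ^ σ * bumpHat (R * (Real.log n - L)) : ℝ) : ℂ) =
      ∫ τ, (bump τ : ℂ) * (Complex.exp (((2 * Real.pi * τ * (R * L) : ℝ) : ℂ) * Complex.I) *
        LSeries (fun n => (a n : ℂ)) (σ + ((2 * Real.pi * R * τ : ℝ) : ℂ) * Complex.I)) := by
  have hterm : ∀ (n : ℕ) (τ : ℝ),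
      (bump τ : ℂ) * (Complex.exp (((2 * Real.pi * τ * (R * L) : ℝ) : ℂ) * Complex.I) *
        LSeries.term (fun n => (a n : ℂ)) (σ + ((2 * Real.pi * R * τ : ℝ) : ℂ) * Complex.I) n) =
      ((a n / (n : ℝ) ^ σ : ℝ) : ℂ) * ((bump τ : ℂ) *
        Complex.exp (((-2 * Real.pi * τ * (R * (Real.log n - L)) : ℝ) : ℂ) * Complex.I)) := by
    intro n τ
    rw [term_vertical a ha]
    rw [show ((-2 * Real.pi * τ * (R * (Real.log n - L)) : ℝ) : ℂ) * Complex.I =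
      ((2 * Real.pi * τ * (R * L) : ℝ) : ℂ) * Complex.I +
        ((-(2 * Real.pi * R * τ) * Real.log n : ℝ) : ℂ) * Complex.I by push_cast; ring,
      Complex.exp_add]
    ring
  have hint : ∀ n : ℕ, ∫ τ, (bump τ : ℂ) *
      (Complex.exp (((2 * Real.pi * τ * (R * L) : ℝ) : ℂ) * Complex.I) *
        LSeries.term (fun n => (a n : ℂ)) (σ + ((2 * Real.pi * R * τ : ℝ) : ℂ) * Complex.I) n) =
      ((a n / (n : ℝ) ^ σ * bumpHat (R * (Real.log n - L)) : ℝ) : ℂ) := by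
    intro n
    simp_rw [hterm]
    rw [integral_const_mul, integral_bump_mul_exp]
    push_cast
    rfl
  rw [Complex.ofReal_tsum]
  simp_rw [← hint, LSeries, ← tsum_mul_left]
  refine integral_tsum_of_summable_integral_norm (fun n => ?_) ?_
  · simp_rw [hterm]
    exact (integrable_bump_mul (by fun_prop)).const_mul _
  · simp_rw [hterm, norm_mul, norm_exp_mul_I, mul_one, integral_const_mul]
    refine Summable.mul_right _ ?_
    refine hs.norm.congr fun n => ?_
    have := term_vertical a ha σ 0 n
    simp only [Complex.ofReal_zero, zero_mul, add_zero, neg_zero, Complex.exp_zero, mul_one] at this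
    rw [this]

/-- The contribution of a simple pole at `1` to the smoothed sum. -/
lemma integral_bump_div (R L : ℝ) {ε : ℝ} (hε : 0 < ε) :
    ∫ τ, (bump τ : ℂ) * (Complex.exp (((2 * Real.pi * τ * (R * L) : ℝ) : ℂ) * Complex.I) *
        (1 / (ε + ((2 * Real.pi * R * τ : ℝ) : ℂ) * Complex.I))) =
      ((∫ u in Set.Ioi (0 : ℝ), Real.exp (-ε * u) * bumpHat (R * (u - L)) : ℝ) : ℂ) := by
  have h1 : ∀ τ : ℝ, 1 / (ε + ((2 * Real.pi * R * τ : ℝ) : ℂ) * Complex.I) =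
      ∫ u in Set.Ioi (0 : ℝ),
        Complex.exp (-(ε + ((2 * Real.pi * R * τ : ℝ) : ℂ) * Complex.I) * (u : ℂ)) := by
    intro τ
    rw [integral_exp_mul_complex_Ioi (by simpa using hε)]
    rw [Complex.ofReal_zero, mul_zero, Complex.exp_zero, neg_div_neg_eq]
  have h2 : ∀ τ u : ℝ, (bump τ : ℂ) *
      (Complex.exp (((2 * Real.pi * τ * (R * L) : ℝ) : ℂ) * Complex.I) *
        Complex.exp (-(ε + ((2 * Real.pi * R * τ : ℝ) : ℂ) * Complex.I) * (u : ℂ))) =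
      (Real.exp (-ε * u) : ℂ) * ((bump τ : ℂ) *
        Complex.exp (((-2 * Real.pi * τ * (R * (u - L)) : ℝ) : ℂ) * Complex.I)) := by
    intro τ u
    rw [← Complex.exp_add, Complex.ofReal_exp, mul_left_comm (Complex.exp _) (bump τ : ℂ),
      ← Complex.exp_add]
    congr 2
    push_cast
    ring
  have h3 : Integrable (Function.uncurry fun (τ u : ℝ) => (Real.exp (-ε * u) : ℂ) * ((bump τ : ℂ) *
        Complex.exp (((-2 * Real.pi * τ * (R * (u - L)) : ℝ) : ℂ) * Complex.I)))
      (volume.prod (volume.restrict (Set.Ioi 0))) := by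
    have hb := (integrable_bump).mul_prod (exp_neg_integrableOn_Ioi 0 hε)
    refine hb.mono' (Continuous.aestronglyMeasurable ?_) (Eventually.of_forall fun p => ?_)
    · have := continuous_bump
      unfold Function.uncurry
      fun_prop
    · simp only [Function.uncurry, norm_mul, norm_exp_mul_I, mul_one, Complex.norm_real,
        Real.norm_eq_abs, Real.abs_exp, abs_of_nonneg (bump_nonneg _)]
      rw [mul_comm]
  simp_rw [h1, ← integral_const_mul, h2]
  rw [integral_integral_swap h3]
  simp_rw [integral_const_mul, integral_bump_mul_exp]
  rw [← integral_complex_ofReal]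
  push_cast
  rfl

/-- The left side is the smoothed Dirichlet sum, split into its pole and its regular part. Terms
outside `S` have nonpositive weight and can be dropped; inside `S` the weight is at most 8. The
right side is free of `ε`, which permits the limit `ε → 0`. -/
lemma smoothed_sum_ge {a : ℕ → ℝ} (ha : a 0 = 0) (hnn : ∀ n, 0 ≤ a n)
    (hs : ∀ s : ℂ, 1 < s.re → LSeriesSummable (fun n => (a n : ℂ)) s)
    {F : ℂ → ℂ} (hF : ContinuousOn F {s | 1 ≤ s.re}) {A : ℝ}
    (hFa : ∀ s : ℂ, 1 < s.re → F s = LSeries (fun n => (a n : ℂ)) s - A / (s - 1))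
    {R : ℝ} (hR : 0 < R) (L : ℝ) {S : Finset ℕ}
    (hS : ∀ n : ℕ, 0 < n → |Real.log n - L| < 3 / R → n ∈ S) {ε : ℝ} (hε : 0 < ε) :
    A * (∫ u in Set.Ioi (0 : ℝ), Real.exp (-ε * u) * bumpHat (R * (u - L))) +
      (∫ τ, (bump τ : ℂ) * (Complex.exp (((2 * Real.pi * τ * (R * L) : ℝ) : ℂ) * Complex.I) *
        F ((1 + ε : ℝ) + ((2 * Real.pi * R * τ : ℝ) : ℂ) * Complex.I))).re
      ≤ 8 * ∑ n ∈ S, a n / n := by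
  have hσ : 1 < ((1 + ε : ℝ) : ℂ).re := by simpa using hε
  have hsum := hs _ hσ
  have hsum' : Summable fun n : ℕ => a n / (n : ℝ) ^ (1 + ε) := by
    refine hsum.norm.congr fun n => ?_
    have := term_vertical a ha (1 + ε) 0 n
    simp only [Complex.ofReal_zero, zero_mul, add_zero, neg_zero, Complex.exp_zero, mul_one] at this
    rw [this, Complex.norm_real, Real.norm_eq_abs, abs_of_nonneg]
    exact div_nonneg (hnn n) (by positivity)
  have hsum8 : Summable fun n : ℕ =>
      a n / (n : ℝ) ^ (1 + ε) * bumpHat (R * (Real.log n - L)) := by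
    refine Summable.of_norm_bounded (hsum'.mul_right 8) fun n => ?_
    rw [norm_mul, Real.norm_eq_abs, Real.norm_eq_abs,
      abs_of_nonneg (div_nonneg (hnn n) (by positivity))]
    exact mul_le_mul_of_nonneg_left (abs_bumpHat_le _) (div_nonneg (hnn n) (by positivity))
  have hline : ∀ τ : ℝ,
      1 < (((1 + ε : ℝ) : ℂ) + ((2 * Real.pi * R * τ : ℝ) : ℂ) * Complex.I).re := by
    intro τ; simpa using hε
  have hident := tsum_mul_bumpHat a ha hsum R L
  have hsplit : ∀ τ : ℝ,
      (bump τ : ℂ) * (Complex.exp (((2 * Real.pi * τ * (R * L) : ℝ) : ℂ) * Complex.I) *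
        LSeries (fun n => (a n : ℂ)) ((1 + ε : ℝ) + ((2 * Real.pi * R * τ : ℝ) : ℂ) * Complex.I)) =
      (bump τ : ℂ) * (Complex.exp (((2 * Real.pi * τ * (R * L) : ℝ) : ℂ) * Complex.I) *
        F ((1 + ε : ℝ) + ((2 * Real.pi * R * τ : ℝ) : ℂ) * Complex.I)) +
      A * ((bump τ : ℂ) * (Complex.exp (((2 * Real.pi * τ * (R * L) : ℝ) : ℂ) * Complex.I) *
        (1 / (ε + ((2 * Real.pi * R * τ : ℝ) : ℂ) * Complex.I)))) := by
    intro τ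
    rw [hFa _ (hline τ)]
    rw [show ((1 + ε : ℝ) : ℂ) + ((2 * Real.pi * R * τ : ℝ) : ℂ) * Complex.I - 1 =
      ε + ((2 * Real.pi * R * τ : ℝ) : ℂ) * Complex.I by push_cast; ring]
    ring
  simp_rw [hsplit] at hident
  rw [integral_add, integral_const_mul, integral_bump_div R L hε] at hident
  · have hre := congrArg Complex.re hident
    rw [Complex.ofReal_re, Complex.add_re, ← Complex.ofReal_mul, Complex.ofReal_re] at hre
    rw [add_comm, ← hre]
    have h1 : ∑' n : ℕ, a n / (n : ℝ) ^ (1 + ε) * bumpHat (R * (Real.log n - L)) ≤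
        ∑ n ∈ S, a n / (n : ℝ) ^ (1 + ε) * bumpHat (R * (Real.log n - L)) := by
      have := hsum8.neg.sum_le_tsum S fun n hn => by
        rw [neg_nonneg]
        rcases Nat.eq_zero_or_pos n with rfl | hpos
        · simp [ha]
        · refine mul_nonpos_of_nonneg_of_nonpos (div_nonneg (hnn n) (by positivity))
            (bumpHat_nonpos ?_)
          rw [abs_mul, abs_of_pos hR]
          have h3 := not_lt.1 fun h => hn (hS n hpos h)
          rwa [div_le_iff₀ hR, mul_comm] at h3
      rw [tsum_neg, Finset.sum_neg_distrib] at this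
      linarith
    refine h1.trans ?_
    rw [Finset.mul_sum]
    refine Finset.sum_le_sum fun n _ => ?_
    rcases Nat.eq_zero_or_pos n with rfl | hpos
    · simp [ha]
    · have hn1 : (1 : ℝ) ≤ n := by exact_mod_cast hpos
      have h4 : a n / (n : ℝ) ^ (1 + ε) ≤ a n / n := by
        refine div_le_div_of_nonneg_left (hnn n) (by linarith) ?_
        calc (n : ℝ) = (n : ℝ) ^ (1 : ℝ) := (Real.rpow_one _).symm
          _ ≤ _ := Real.rpow_le_rpow_of_exponent_le hn1 (by linarith)
      calc _ ≤ a n / (n : ℝ) ^ (1 + ε) * 8 :=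
            mul_le_mul_of_nonneg_left ((le_abs_self _).trans (abs_bumpHat_le _))
              (div_nonneg (hnn n) (by positivity))
        _ ≤ a n / n * 8 := by gcongr
        _ = _ := mul_comm _ _
  · refine integrable_bump_mul (Continuous.mul (by fun_prop) ?_)
    exact hF.comp_continuous (by fun_prop) fun τ => (hline τ).le
  · refine (integrable_bump_mul (Continuous.mul (by fun_prop) ?_)).const_mul _
    refine continuous_const.div (by fun_prop) fun τ h => ?_
    have := congrArg Complex.re h
    simp at this
    linarith

lemma tendsto_pole_term {R : ℝ} (hR : 0 < R) (L : ℝ) :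
    Tendsto (fun ε : ℝ => ∫ u in Set.Ioi (0 : ℝ), Real.exp (-ε * u) * bumpHat (R * (u - L)))
      (𝓝[>] 0) (𝓝 (∫ u in Set.Ioi (0 : ℝ), bumpHat (R * (u - L)))) := by
  have hc := continuous_bumpHat
  have hi : Integrable fun u => bumpHat (R * (u - L)) :=
    (integrable_bumpHat.comp_mul_left' hR.ne').comp_sub_right L
  refine tendsto_integral_filter_of_dominated_convergence (fun u => |bumpHat (R * (u - L))|)
    (Eventually.of_forall fun ε => Continuous.aestronglyMeasurable (by fun_prop)) ?_
    hi.abs.integrableOn (Eventually.of_forall fun u => ?_)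
  · filter_upwards [self_mem_nhdsWithin] with ε hε
    filter_upwards [ae_restrict_mem measurableSet_Ioi] with u hu
    rw [norm_mul, Real.norm_eq_abs, Real.norm_eq_abs, Real.abs_exp]
    refine mul_le_of_le_one_left (abs_nonneg _) (Real.exp_le_one_iff.2 ?_)
    have := mul_pos (Set.mem_Ioi.1 hε) (Set.mem_Ioi.1 hu)
    linarith
  · have : Continuous fun ε : ℝ => Real.exp (-ε * u) * bumpHat (R * (u - L)) := by fun_prop
    have h := this.tendsto 0
    simp only [neg_zero, zero_mul, Real.exp_zero, one_mul] at h
    exact h.mono_left nhdsWithin_le_nhds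

/-- Dominated convergence: the bump confines the integral to a compact vertical segment, so `F` is
bounded on the rectangle swept out for `ε` in [0, 1]. -/
lemma tendsto_regular_term {F : ℂ → ℂ} (hF : ContinuousOn F {s | 1 ≤ s.re}) (R L : ℝ) :
    Tendsto (fun ε : ℝ => ∫ τ, (bump τ : ℂ) *
        (Complex.exp (((2 * Real.pi * τ * (R * L) : ℝ) : ℂ) * Complex.I) *
        F ((1 + ε : ℝ) + ((2 * Real.pi * R * τ : ℝ) : ℂ) * Complex.I)))
      (𝓝[>] 0) (𝓝 (∫ τ, (bump τ : ℂ) *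
        (Complex.exp (((2 * Real.pi * τ * (R * L) : ℝ) : ℂ) * Complex.I) *
        F ((1 : ℝ) + ((2 * Real.pi * R * τ : ℝ) : ℂ) * Complex.I)))) := by
  have hK : IsCompact ((fun p : ℝ × ℝ => ((1 + p.1 : ℝ) : ℂ) +
      ((2 * Real.pi * R * p.2 : ℝ) : ℂ) * Complex.I) '' (Set.Icc 0 1 ×ˢ Set.Icc (-1) 1)) :=
    (isCompact_Icc.prod isCompact_Icc).image (by fun_prop)
  obtain ⟨C, hC⟩ := hK.exists_bound_of_continuousOn (hF.mono (by
    rintro _ ⟨p, hp, rfl⟩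
    simpa using hp.1.1))
  have hline : ∀ ε : ℝ, 0 ≤ ε → Continuous fun τ : ℝ =>
      F ((1 + ε : ℝ) + ((2 * Real.pi * R * τ : ℝ) : ℂ) * Complex.I) := fun ε hε =>
    hF.comp_continuous (by fun_prop) fun τ => by simpa using hε
  refine tendsto_integral_filter_of_dominated_convergence (fun τ => bump τ * C) ?_ ?_
    (integrable_bump.mul_const C) (Eventually.of_forall fun τ => ?_)
  · filter_upwards [self_mem_nhdsWithin] with ε hε
    exact ((Complex.continuous_ofReal.comp continuous_bump).mul
      (Continuous.mul (by fun_prop) (hline ε (Set.mem_Ioi.1 hε).le))).aestronglyMeasurable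
  · filter_upwards [Ioc_mem_nhdsGT zero_lt_one] with ε hε
    refine Eventually.of_forall fun τ => ?_
    rw [norm_mul, norm_mul, norm_exp_mul_I, one_mul, Complex.norm_real, Real.norm_eq_abs,
      abs_of_nonneg (bump_nonneg τ)]
    rcases le_total 1 |τ| with h | h
    · rw [bump_eq_zero h]; simp
    · exact mul_le_mul_of_nonneg_left
        (hC _ ⟨(ε, τ), ⟨⟨hε.1.le, hε.2⟩, abs_le.1 h⟩, rfl⟩) (bump_nonneg τ)
  · refine (Tendsto.const_mul _ ?_).const_mul _
    have h1 : ContinuousWithinAt F {s | 1 ≤ s.re}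
        ((1 : ℝ) + ((2 * Real.pi * R * τ : ℝ) : ℂ) * Complex.I) := hF _ (by simp)
    refine h1.tendsto.comp (tendsto_nhdsWithin_iff.2 ⟨?_, ?_⟩)
    · have : Continuous fun ε : ℝ =>
        ((1 + ε : ℝ) : ℂ) + ((2 * Real.pi * R * τ : ℝ) : ℂ) * Complex.I := by fun_prop
      have h := this.tendsto 0
      simp only [add_zero] at h
      exact h.mono_left nhdsWithin_le_nhds
    · filter_upwards [self_mem_nhdsWithin] with ε hε
      simpa using (Set.mem_Ioi.1 hε).le

lemma tendsto_integral_bumpHat_atTop {R : ℝ} (hR : 0 < R) :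
    Tendsto (fun L : ℝ => ∫ u in Set.Ioi (0 : ℝ), bumpHat (R * (u - L))) atTop (𝓝 R⁻¹) := by
  have hi : Integrable fun u => bumpHat (R * u) := integrable_bumpHat.comp_mul_left' hR.ne'
  have h1 : ∫ u, bumpHat (R * u) = R⁻¹ := by
    rw [Measure.integral_comp_mul_left bumpHat R, integral_bumpHat, abs_of_pos (by positivity)]
    simp
  rw [← h1]
  have h2 : ∀ L : ℝ, ∫ u in Set.Ioi (0 : ℝ), bumpHat (R * (u - L)) =
      ∫ u in Set.Ioi (-L), bumpHat (R * u) := by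
    intro L
    rw [← integral_indicator measurableSet_Ioi, ← integral_indicator measurableSet_Ioi,
      ← integral_sub_right_eq_self (fun u => Set.indicator (Set.Ioi (-L)) _ u) L]
    congr 1
    ext u
    simp only [Set.indicator, Set.mem_Ioi, neg_lt_sub_iff_lt_add, lt_add_iff_pos_right]
  simp_rw [h2]
  exact (aecover_Ioi tendsto_neg_atTop_atBot).integral_tendsto_of_countably_generated hi

/-- A lower bound of Wiener-Ikehara type for short logarithmic intervals. -/
theorem eventually_le_sum_div {a : ℕ → ℝ} (ha : a 0 = 0) (hnn : ∀ n, 0 ≤ a n)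
    (hs : ∀ s : ℂ, 1 < s.re → LSeriesSummable (fun n => (a n : ℂ)) s)
    {F : ℂ → ℂ} (hF : ContinuousOn F {s | 1 ≤ s.re}) {A : ℝ} (hA : 0 < A)
    (hFa : ∀ s : ℂ, 1 < s.re → F s = LSeries (fun n => (a n : ℂ)) s - A / (s - 1))
    {R : ℝ} (hR : 0 < R) {S : ℝ → Finset ℕ}
    (hS : ∀ L : ℝ, ∀ n : ℕ, 0 < n → |Real.log n - L| < 3 / R → n ∈ S L) :
    ∀ᶠ L in atTop, A / (16 * R) ≤ ∑ n ∈ S L, a n / n := by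
  have hle : ∀ L : ℝ, A * (∫ u in Set.Ioi (0 : ℝ), bumpHat (R * (u - L))) +
      (∫ τ, (bump τ : ℂ) * (Complex.exp (((2 * Real.pi * τ * (R * L) : ℝ) : ℂ) * Complex.I) *
        F ((1 : ℝ) + ((2 * Real.pi * R * τ : ℝ) : ℂ) * Complex.I))).re
      ≤ 8 * ∑ n ∈ S L, a n / n := fun L =>
    le_of_tendsto (((tendsto_pole_term hR L).const_mul A).add
      ((Complex.continuous_re.tendsto _).comp (tendsto_regular_term hF R L)))
      (by filter_upwards [self_mem_nhdsWithin] with ε hε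
          exact smoothed_sum_ge ha hnn hs hF hFa hR L (hS L) hε)
  -- The regular part is a Fourier transform evaluated at frequency `-R L`, so it vanishes in the
  -- limit by the Riemann-Lebesgue lemma.
  have hRL : Tendsto (fun L : ℝ => ∫ τ, (bump τ : ℂ) *
      (Complex.exp (((2 * Real.pi * τ * (R * L) : ℝ) : ℂ) * Complex.I) *
        F ((1 : ℝ) + ((2 * Real.pi * R * τ : ℝ) : ℂ) * Complex.I))) atTop (𝓝 0) := by
    have h := (Real.zero_at_infty_fourier (fun τ : ℝ => (bump τ : ℂ) *
      F ((1 : ℝ) + ((2 * Real.pi * R * τ : ℝ) : ℂ) * Complex.I))).mono_left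
      (atBot_le_cocompact (α := ℝ))
    have h2 : Tendsto (fun L : ℝ => -(R * L)) atTop atBot :=
      tendsto_neg_atTop_atBot.comp (tendsto_id.const_mul_atTop hR)
    refine (h.comp h2).congr fun L => ?_
    rw [Function.comp_apply, Real.fourier_real_eq_integral_exp_smul]
    refine integral_congr_ae (Eventually.of_forall fun τ => ?_)
    simp only [smul_eq_mul]
    rw [show -2 * Real.pi * τ * -(R * L) = 2 * Real.pi * τ * (R * L) by ring]
    ring
  have hlim := ((tendsto_integral_bumpHat_atTop hR).const_mul A).add
    ((Complex.continuous_re.tendsto _).comp hRL)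
  -- Half of the limiting value is given away; dividing by the weight bound 8 yields the constant
  -- 16.
  have hpos : A / (2 * R) < A * R⁻¹ + Complex.re 0 := by
    rw [Complex.zero_re, add_zero, ← div_eq_mul_inv]
    exact div_lt_div_of_pos_left hA hR (by linarith)
  filter_upwards [hlim.eventually_const_lt hpos] with L hL
  have h3 := hL.le.trans (hle L)
  have h4 : A / (16 * R) = A / (2 * R) / 8 := by
    rw [div_div]; congr 1; ring
  rw [h4, div_le_iff₀ (by norm_num)]
  linarith

/-! ### Primes congruent to 2 modulo 3 in short intervals -/

/-- Primes congruent to `2` modulo `3` are dense on the logarithmic scale. -/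
theorem eventually_exists_prime_mod_three {δ : ℝ} (hδ : 0 < δ) :
    ∀ᶠ x : ℝ in atTop, ∃ p : ℕ, p.Prime ∧ p % 3 = 2 ∧ x ≤ p ∧ p ≤ (1 + δ) * x := by
  have hu : IsUnit (2 : ZMod 3) := by decide
  set a : ℕ → ℝ := ArithmeticFunction.vonMangoldt.residueClass (2 : ZMod 3) with ha
  set l := Real.log (1 + δ) with hl
  have hlpos : 0 < l := Real.log_pos (by linarith)
  -- With this scale the window |log n - L| < 3/R has half-width l/2; centred at L = log x + l/2 it
  -- is the interval from x to (1+δ)x.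
  set R := 6 / l with hRdef
  have hR : 0 < R := by positivity
  have h3R : 3 / R = l / 2 := by rw [hRdef]; field_simp; norm_num
  set S : ℝ → Finset ℕ := fun L =>
    Finset.Icc ⌈Real.exp (L - l / 2)⌉₊ ⌊Real.exp (L + l / 2)⌋₊ with hSdef
  have hS : ∀ L : ℝ, ∀ n : ℕ, 0 < n → |Real.log n - L| < 3 / R → n ∈ S L := by
    intro L n hn h
    rw [h3R, abs_lt] at h
    have hn' : (0 : ℝ) < n := by exact_mod_cast hn
    rw [hSdef]
    refine Finset.mem_Icc.2 ⟨Nat.ceil_le.2 ?_, Nat.le_floor ?_⟩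
    · rw [← Real.le_log_iff_exp_le hn']; linarith
    · rw [← Real.log_le_iff_le_exp hn']; linarith
  have hmain := eventually_le_sum_div (A := ((3 : ℕ).totient : ℝ)⁻¹)
    (ArithmeticFunction.vonMangoldt.residueClass_apply_zero _)
    (ArithmeticFunction.vonMangoldt.residueClass_nonneg _)
    (fun s h => LSeriesSummable_of_abscissaOfAbsConv_lt_re
      ((ArithmeticFunction.vonMangoldt.abscissaOfAbsConv_residueClass_le_one (2 : ZMod 3)).trans_lt
        (by exact_mod_cast h)))
    (ArithmeticFunction.vonMangoldt.continuousOn_LFunctionResidueClassAux (2 : ZMod 3))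
    (by have := Nat.totient_pos.2 (by norm_num : 0 < 3); positivity)
    (fun s h => by
      rw [ArithmeticFunction.vonMangoldt.eqOn_LFunctionResidueClassAux hu h]
      push_cast
      rfl) hR hS
  set c : ℝ := ((3 : ℕ).totient : ℝ)⁻¹ / (16 * R) with hc
  have hcpos : 0 < c := by
    have := Nat.totient_pos.2 (by norm_num : 0 < 3)
    positivity
  -- Non-prime prime powers have a convergent sum of Λ(n)/n, so beyond a finite set they contribute
  -- less than the lower bound `c`. A prime must then occur.
  obtain ⟨s, hs⟩ := (summable_iff_vanishing_norm.1
    (ArithmeticFunction.vonMangoldt.summable_residueClass_non_primes_div (a := (2 : ZMod 3)))) c hcpos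
  have hev : ∀ᶠ L : ℝ in atTop, Disjoint (S L) s := by
    have ht : Tendsto (fun L : ℝ => Real.exp (L - l / 2)) atTop atTop :=
      Real.tendsto_exp_atTop.comp (tendsto_atTop_add_const_right _ _ tendsto_id)
    filter_upwards [ht.eventually_gt_atTop ((s.sup id : ℕ) : ℝ)] with L hL
    refine Finset.disjoint_left.2 fun n hn hns => ?_
    have h1 : n ≤ s.sup id := Finset.le_sup (f := id) hns
    have h2 := Nat.ceil_le.1 (Finset.mem_Icc.1 hn).1
    have h3 : (n : ℝ) ≤ ((s.sup id : ℕ) : ℝ) := by exact_mod_cast h1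
    linarith
  have hL : Tendsto (fun x : ℝ => Real.log x + l / 2) atTop atTop :=
    tendsto_atTop_add_const_right _ _ Real.tendsto_log_atTop
  filter_upwards [hL.eventually (hmain.and hev), eventually_gt_atTop 0] with x hx hx0
  obtain ⟨h1, h2⟩ := hx
  by_contra hno
  push Not at hno
  have h3 := hs _ h2
  have h4 : ∑ n ∈ S (Real.log x + l / 2), a n / n =
      ∑ n ∈ S (Real.log x + l / 2), (if n.Prime then 0 else a n) / n := by
    refine Finset.sum_congr rfl fun n hn => ?_
    split_ifs with hp
    · have hmem := Finset.mem_Icc.1 hn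
      have h5 := Nat.ceil_le.1 hmem.1
      have h6 := (Nat.le_floor_iff (by positivity)).1 hmem.2
      rw [add_sub_cancel_right, Real.exp_log hx0] at h5
      rw [add_assoc, add_halves, Real.exp_add, Real.exp_log hx0, hl,
        Real.exp_log (by linarith)] at h6
      have h7 : n % 3 ≠ 2 := fun h => (hno n hp h h5).not_ge (by linarith)
      have h8 : a n = 0 := by
        rw [ha, ArithmeticFunction.vonMangoldt.residueClass, Set.indicator_of_notMem]
        intro h
        refine h7 ?_
        have h' : (n : ZMod 3) = ((2 : ℕ) : ZMod 3) := by exact_mod_cast h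
        exact (ZMod.natCast_eq_natCast_iff' _ _ _).1 h'
      rw [h8]
    · rfl
  rw [h4] at h1
  rw [Real.norm_eq_abs] at h3
  exact absurd (h1.trans (le_abs_self _)) (not_le.2 h3)

end PrimeGap

namespace TranspositionCodes

open Filter Topology Polynomial

/-! ### Transposition patterns as involutions -/

/-- The action on positions of the transpositions at the locations in `K`. -/
def swapIdx (K : Finset ℕ) (i : ℕ) : ℕ :=
  if i ∈ K then i + 1 else if 1 ≤ i ∧ i - 1 ∈ K then i - 1 else i

/-- The string obtained by performing the transpositions at the locations in `K`. -/
def transpose {n q : ℕ} (K : Finset ℕ) (x : Fin n → Fin q) : Fin n → Fin q :=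
  fun i => if h : swapIdx K i < n then x ⟨swapIdx K i, h⟩ else x i

lemma IsPattern.mono {n : ℕ} {K K' : Finset ℕ} (hK : IsPattern n K) (h : K' ⊆ K) :
    IsPattern n K' :=
  ⟨fun k hk => hK.1 k (h hk), fun j hj k hk => hK.2 j (h hj) k (h hk)⟩

lemma IsPattern.succ_notMem {n : ℕ} {K : Finset ℕ} (hK : IsPattern n K) {k : ℕ} (hk : k ∈ K) :
    k + 1 ∉ K := fun h => by
  have := hK.2 k hk (k + 1) h (by omega)
  omega

lemma IsPattern.swapIdx_lt {n : ℕ} {K : Finset ℕ} (hK : IsPattern n K) {i : ℕ} (hi : i < n) :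
    swapIdx K i < n := by
  unfold swapIdx
  split_ifs with h1 h2
  · exact hK.1 i h1
  · omega
  · exact hi

lemma IsPattern.swapIdx_swapIdx {n : ℕ} {K : Finset ℕ} (hK : IsPattern n K) (i : ℕ) :
    swapIdx K (swapIdx K i) = i := by
  by_cases h1 : i ∈ K
  · have := hK.succ_notMem h1
    simp [swapIdx, h1, this]
  · by_cases h2 : 1 ≤ i ∧ i - 1 ∈ K
    · have : i - 1 + 1 = i := by omega
      simp [swapIdx, h1, h2, this]
    · simp [swapIdx, h1, h2]

lemma IsPattern.transpose_apply {n q : ℕ} {K : Finset ℕ} (hK : IsPattern n K)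
    (x : Fin n → Fin q) (i : Fin n) :
    transpose K x i = x ⟨swapIdx K i, hK.swapIdx_lt i.2⟩ := by
  simp [transpose, hK.swapIdx_lt i.2]

lemma IsPattern.transpose_transpose {n q : ℕ} {K : Finset ℕ} (hK : IsPattern n K)
    (x : Fin n → Fin q) : transpose K (transpose K x) = x := by
  ext1 i
  simp [hK.transpose_apply, hK.swapIdx_swapIdx]

lemma IsPattern.isTransposed_iff {n q : ℕ} {K : Finset ℕ} (hK : IsPattern n K)
    {x y : Fin n → Fin q} : IsTransposed K x y ↔ y = transpose K x := by
  constructor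
  · rintro ⟨h1, h2⟩
    ext1 i
    rw [hK.transpose_apply]
    by_cases hi : (i : ℕ) ∈ K
    · have h : swapIdx K i = i + 1 := by simp [swapIdx, hi]
      simp only [h]
      exact (h1 i hi (hK.1 i hi)).1
    · by_cases hi2 : 1 ≤ (i : ℕ) ∧ (i : ℕ) - 1 ∈ K
      · have h : swapIdx K i = i - 1 := by simp [swapIdx, hi, hi2]
        simp only [h]
        have hlt : (i : ℕ) - 1 + 1 < n := by have := i.2; omega
        have h3 := (h1 _ hi2.2 hlt).2
        rw [← h3]
        congr 1
        ext
        simp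
        omega
      · have h : swapIdx K i = i := by simp [swapIdx, hi, hi2]
        simp only [h]
        refine h2 i fun k hk => ⟨fun h => hi (h ▸ hk), fun h => hi2 ⟨by omega, ?_⟩⟩
        rw [h, Nat.add_sub_cancel]
        exact hk
  · rintro rfl
    refine ⟨fun k hk h => ⟨?_, ?_⟩, fun i hi => ?_⟩
    · simp [hK.transpose_apply, swapIdx, hk]
    · simp [hK.transpose_apply, swapIdx, hk, hK.succ_notMem hk]
    · rw [hK.transpose_apply]
      have h1 : (i : ℕ) ∉ K := fun h => (hi _ h).1 rfl
      have h2 : ¬ (1 ≤ (i : ℕ) ∧ (i : ℕ) - 1 ∈ K) := fun h => (hi _ h.2).2 (by omega)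
      simp [swapIdx, h1, h2]

lemma mem_outputs_iff {n q t : ℕ} {x y : Fin n → Fin q} :
    y ∈ outputs x t ↔ ∃ K : Finset ℕ, IsPattern n K ∧ K.card ≤ t ∧ y = transpose K x := by
  constructor
  · rintro ⟨K, h1, h2, h3⟩
    exact ⟨K, h1, h2, h1.isTransposed_iff.1 h3⟩
  · rintro ⟨K, h1, h2, h3⟩
    exact ⟨K, h1, h2, h1.isTransposed_iff.2 h3⟩

lemma isPattern_symmDiff {n : ℕ} {K₁ K₂ : Finset ℕ} (h₁ : IsPattern n K₁) (h₂ : IsPattern n K₂)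
    (h : ∀ j ∈ K₁, ∀ k ∈ K₂, j ≠ k + 1 ∧ k ≠ j + 1) : IsPattern n (symmDiff K₁ K₂) := by
  refine ⟨fun k hk => ?_, fun j hj k hk hjk => ?_⟩
  · rcases Finset.mem_symmDiff.1 hk with hk | hk
    · exact h₁.1 k hk.1
    · exact h₂.1 k hk.1
  · rcases Finset.mem_symmDiff.1 hk with hk | hk <;> rcases Finset.mem_symmDiff.1 hj with hj | hj
    · exact h₁.2 j hj.1 k hk.1 hjk
    · have := h k hk.1 j hj.1; omega
    · have := h j hj.1 k hk.1; omega
    · exact h₂.2 j hj.1 k hk.1 hjk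

/-- Without neighbouring locations, swaps from the two patterns either coincide and cancel or act on
disjoint pairs. -/
lemma IsPattern.transpose_transpose_eq {n q : ℕ} {K₁ K₂ : Finset ℕ} (h₁ : IsPattern n K₁)
    (h₂ : IsPattern n K₂) (h : ∀ j ∈ K₁, ∀ k ∈ K₂, j ≠ k + 1 ∧ k ≠ j + 1) (x : Fin n → Fin q) :
    transpose K₁ (transpose K₂ x) = transpose (symmDiff K₁ K₂) x := by
  ext1 i
  rw [h₁.transpose_apply, h₂.transpose_apply, (isPattern_symmDiff h₁ h₂ h).transpose_apply]
  congr 2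
  have hs : ∀ m, m ∈ symmDiff K₁ K₂ ↔ (m ∈ K₁ ∧ m ∉ K₂) ∨ (m ∈ K₂ ∧ m ∉ K₁) := fun m =>
    Finset.mem_symmDiff
  obtain ⟨i, hi⟩ := i
  simp only
  have a1 : i ∈ K₁ → i + 1 ∉ K₁ := h₁.succ_notMem
  have a2 : i ∈ K₁ → i + 1 ∉ K₂ := fun h1 h2 => (h i h1 _ h2).2 rfl
  have a3 : i ∈ K₂ → i + 1 ∉ K₁ := fun h1 h2 => (h _ h2 i h1).1 rfl
  have a4 : i ∈ K₂ → i + 1 ∉ K₂ := h₂.succ_notMem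
  rcases Nat.eq_zero_or_pos i with rfl | hpos
  · by_cases p1 : 0 ∈ K₁ <;> by_cases p2 : 0 ∈ K₂ <;> simp_all [swapIdx]
  · obtain ⟨m, rfl⟩ : ∃ m, i = m + 1 := ⟨i - 1, by omega⟩
    have b1 : m ∈ K₁ → m + 1 ∉ K₁ := h₁.succ_notMem
    have b2 : m ∈ K₁ → m + 1 ∉ K₂ := fun h1 h2 => (h m h1 _ h2).2 rfl
    have b3 : m ∈ K₂ → m + 1 ∉ K₁ := fun h1 h2 => (h _ h2 m h1).1 rfl
    have b4 : m ∈ K₂ → m + 1 ∉ K₂ := h₂.succ_notMem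
    have b5 : m ∈ K₁ → 1 ≤ m → m - 1 ∉ K₂ := fun h1 h2 h3 => (h m h1 _ h3).1 (by omega)
    clear h h₁ h₂
    by_cases p1 : m + 1 ∈ K₁ <;> by_cases p2 : m + 1 ∈ K₂ <;> by_cases p3 : m ∈ K₁ <;>
      by_cases p4 : m ∈ K₂ <;> simp_all [swapIdx]

lemma card_le_maxCodeSize {n q t : ℕ} {C : Finset (Fin n → Fin q)} (hne : C.Nonempty)
    (hC : Corrects C t) : C.card ≤ maxCodeSize q n t := by
  classical
  unfold maxCodeSize
  exact Finset.le_sup (f := Finset.card) (Finset.mem_filter.2 ⟨Finset.mem_univ _, hne, hC⟩)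

lemma exists_card_eq_maxCodeSize {q : ℕ} (hq : 0 < q) (n t : ℕ) :
    ∃ C : Finset (Fin n → Fin q), C.Nonempty ∧ Corrects C t ∧ C.card = maxCodeSize q n t := by
  classical
  have : Nonempty (Fin q) := ⟨⟨0, hq⟩⟩
  have hne : ((Finset.univ : Finset (Finset (Fin n → Fin q))).filter
      (fun C => C.Nonempty ∧ Corrects C t)).Nonempty := by
    refine ⟨{Classical.arbitrary _}, Finset.mem_filter.2 ⟨Finset.mem_univ _, by simp, ?_⟩⟩
    intro x hx x' hx' h
    exact absurd ((Finset.mem_singleton.1 hx).trans (Finset.mem_singleton.1 hx').symm) h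
  obtain ⟨C, hC, h⟩ := Finset.exists_mem_eq_sup _ hne Finset.card
  refine ⟨C, (Finset.mem_filter.1 hC).2.1, (Finset.mem_filter.1 hC).2.2, ?_⟩
  unfold maxCodeSize
  convert! h.symm

lemma maxCodeSize_pos {q : ℕ} (hq : 0 < q) (n t : ℕ) : 0 < maxCodeSize q n t := by
  obtain ⟨C, h1, -, h3⟩ := exists_card_eq_maxCodeSize hq n t
  exact h3 ▸ h1.card_pos

lemma asympLE_of_forall_eventually {a b : ℕ → ℝ} (hb : ∀ᶠ n in atTop, 0 < b n)
    (h : ∀ η : ℝ, 0 < η → ∀ᶠ n in atTop, a n ≤ (1 + η) * b n) : AsympLE a b := by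
  have key : ∀ η : ℝ, 0 < η →
      limsup (fun n => ((a n / b n : ℝ) : EReal)) atTop ≤ ((1 + η : ℝ) : EReal) := by
    intro η hη
    refine limsup_le_of_le (h := ?_)
    filter_upwards [hb, h η hη] with n h1 h2
    exact EReal.coe_le_coe_iff.2 ((div_le_iff₀ h1).2 h2)
  unfold AsympLE
  refine le_of_forall_gt_imp_ge_of_dense fun c hc => ?_
  induction c with
  | bot => simp at hc
  | top => exact le_top
  | coe c =>
    have hc' : 1 < c := by exact_mod_cast hc
    have := key (c - 1) (by linarith)
    rwa [add_sub_cancel] at this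

/-! ### Counting confusable strings and the Gilbert-Varshamov bound -/

/-- The sets of at most `m` natural numbers below `n`. -/
def smallSets (n m : ℕ) : Finset (Finset ℕ) := (Finset.range n).powerset.filter (·.card ≤ m)

lemma mem_smallSets {n m : ℕ} {K : Finset ℕ} :
    K ∈ smallSets n m ↔ (∀ k ∈ K, k < n) ∧ K.card ≤ m := by
  simp [smallSets, Finset.subset_iff]

lemma IsPattern.mem_smallSets {n m : ℕ} {K : Finset ℕ} (hK : IsPattern n K) (h : K.card ≤ m) :
    K ∈ smallSets n m :=
  TranspositionCodes.mem_smallSets.2 ⟨fun k hk => by have := hK.1 k hk; omega, h⟩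

lemma card_smallSets (n m : ℕ) :
    (smallSets n m).card = ∑ i ∈ Finset.range (m + 1), n.choose i := by
  have : smallSets n m =
      (Finset.range (m + 1)).biUnion fun i => (Finset.range n).powersetCard i := by
    ext K
    simp [smallSets, Finset.mem_powersetCard]
    tauto
  rw [this, Finset.card_biUnion]
  · simp
  · intro i _ j _ hij
    exact Finset.pairwise_disjoint_powersetCard _ hij

lemma card_smallSets_le_pow (n m : ℕ) : (smallSets n m).card ≤ (n + 1) ^ m := by
  rw [card_smallSets, add_pow]
  refine Finset.sum_le_sum fun i hi => ?_
  rw [one_pow, mul_one]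
  have h1 : 1 ≤ m.choose i := Nat.choose_pos (Nat.lt_succ_iff.1 (Finset.mem_range.1 hi))
  calc n.choose i ≤ n ^ i := Nat.choose_le_pow n i
    _ = n ^ i * 1 := (mul_one _).symm
    _ ≤ _ := by push_cast; exact Nat.mul_le_mul_left _ h1

lemma card_smallSets_succ_le (n m : ℕ) :
    ((smallSets n (m + 1)).card : ℝ) ≤ (n : ℝ) ^ (m + 1) / (m + 1).factorial + (n + 1 : ℝ) ^ m := by
  rw [card_smallSets, Finset.sum_range_succ, ← card_smallSets]
  push_cast
  have h1 : ((smallSets n m).card : ℝ) ≤ (n + 1 : ℝ) ^ m := by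
    exact_mod_cast card_smallSets_le_pow n m
  have h2 := Nat.choose_le_pow_div (α := ℝ) (m + 1) n
  linarith

/-- Pairs of sets of at most `t` locations that contain neighbouring locations. -/
def touchingPairs (n t : ℕ) : Finset (Finset ℕ × Finset ℕ) :=
  (smallSets n t ×ˢ smallSets n t).filter fun P => ∃ j ∈ P.1, ∃ k ∈ P.2, j = k + 1 ∨ k = j + 1

/-- The neighbouring locations have one degree of freedom instead of two: a base point and an
orientation determine both. Removing them leaves two sets of at most `t - 1` locations, so the order
is n^(2t-1). -/
lemma card_touchingPairs_le (n t : ℕ) (ht : 1 ≤ t) :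
    (touchingPairs n t).card ≤ 2 * n * ((n + 1) ^ (t - 1) * (n + 1) ^ (t - 1)) := by
  classical
  set D := (Finset.range n ×ˢ (Finset.univ : Finset Bool)) ×ˢ
    (smallSets n (t - 1) ×ˢ smallSets n (t - 1)) with hD
  set f : (ℕ × Bool) × (Finset ℕ × Finset ℕ) → Finset ℕ × Finset ℕ := fun z =>
    if z.1.2 then (insert (z.1.1 + 1) z.2.1, insert z.1.1 z.2.2)
    else (insert z.1.1 z.2.1, insert (z.1.1 + 1) z.2.2) with hf
  have hsub : touchingPairs n t ⊆ D.image f := by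
    rintro ⟨K₁, K₂⟩ h
    obtain ⟨hm, j, hj, k, hk, hjk⟩ := Finset.mem_filter.1 h
    obtain ⟨h1, h2⟩ := Finset.mem_product.1 hm
    rw [mem_smallSets] at h1 h2
    simp only at h1 h2 hj hk
    have e1 : K₁.erase j ∈ smallSets n (t - 1) := mem_smallSets.2
      ⟨fun m hm => h1.1 m (Finset.mem_of_mem_erase hm), by
        rw [Finset.card_erase_of_mem hj]; omega⟩
    have e2 : K₂.erase k ∈ smallSets n (t - 1) := mem_smallSets.2
      ⟨fun m hm => h2.1 m (Finset.mem_of_mem_erase hm), by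
        rw [Finset.card_erase_of_mem hk]; omega⟩
    rcases hjk with rfl | rfl
    · refine Finset.mem_image.2 ⟨((k, true), (K₁.erase (k + 1), K₂.erase k)), ?_, ?_⟩
      · simp [hD, e1, e2, h2.1 k hk]
      · simp [hf, Finset.insert_erase hj, Finset.insert_erase hk]
    · refine Finset.mem_image.2 ⟨((j, false), (K₁.erase j, K₂.erase (j + 1))), ?_, ?_⟩
      · simp [hD, e1, e2, h1.1 j hj]
      · simp [hf, Finset.insert_erase hj, Finset.insert_erase hk]
  refine (Finset.card_le_card hsub).trans (Finset.card_image_le.trans ?_)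
  rw [hD]
  simp only [Finset.card_product, Finset.card_range, Finset.card_univ, Fintype.card_bool]
  rw [mul_comm n 2]
  exact Nat.mul_le_mul_left _ (Nat.mul_le_mul (card_smallSets_le_pow _ _)
    (card_smallSets_le_pow _ _))

open Classical in
/-- The strings that are confusable with `x` under `t` transpositions. -/
noncomputable def confusable {n q : ℕ} (x : Fin n → Fin q) (t : ℕ) : Finset (Fin n → Fin q) :=
  Finset.univ.filter fun x' => (outputs x t ∩ outputs x' t).Nonempty

lemma self_mem_outputs {n q : ℕ} (x : Fin n → Fin q) (t : ℕ) : x ∈ outputs x t := by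
  refine mem_outputs_iff.2 ⟨∅, ⟨by simp, by simp⟩, by simp, ?_⟩
  ext1 i
  simp [transpose, swapIdx]

lemma card_confusable_le {n q t : ℕ} (ht : 1 ≤ t) (x : Fin n → Fin q) :
    (confusable x t).card ≤ (smallSets n (2 * t)).card +
      2 * n * ((n + 1) ^ (t - 1) * (n + 1) ^ (t - 1)) := by
  classical
  have hsub : confusable x t ⊆ (smallSets n (2 * t)).image (fun K => transpose K x) ∪
      (touchingPairs n t).image (fun P => transpose P.2 (transpose P.1 x)) := by
    intro x' hx'
    obtain ⟨y, hy, hy'⟩ := (Finset.mem_filter.1 hx').2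
    obtain ⟨K₁, h1, c1, rfl⟩ := mem_outputs_iff.1 hy
    obtain ⟨K₂, h2, c2, e2⟩ := mem_outputs_iff.1 hy'
    have hx : transpose K₂ (transpose K₁ x) = x' := by rw [e2, h2.transpose_transpose]
    by_cases htouch : ∃ j ∈ K₁, ∃ k ∈ K₂, j = k + 1 ∨ k = j + 1
    · exact Finset.mem_union_right _ (Finset.mem_image.2 ⟨(K₁, K₂), Finset.mem_filter.2
        ⟨Finset.mem_product.2 ⟨h1.mem_smallSets c1, h2.mem_smallSets c2⟩, htouch⟩, hx⟩)
    · push Not at htouch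
      have hno : ∀ j ∈ K₂, ∀ k ∈ K₁, j ≠ k + 1 ∧ k ≠ j + 1 := fun j hj k hk =>
        ⟨(htouch k hk j hj).2, (htouch k hk j hj).1⟩
      refine Finset.mem_union_left _ (Finset.mem_image.2 ⟨symmDiff K₂ K₁, ?_, ?_⟩)
      · refine (isPattern_symmDiff h2 h1 hno).mem_smallSets ?_
        have : symmDiff K₂ K₁ ⊆ K₂ ∪ K₁ := symmDiff_le_sup
        calc _ ≤ (K₂ ∪ K₁).card := Finset.card_le_card this
          _ ≤ _ := Finset.card_union_le _ _
          _ ≤ _ := by omega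
      · rw [← h2.transpose_transpose_eq h1 hno, hx]
  refine (Finset.card_le_card hsub).trans ((Finset.card_union_le _ _).trans ?_)
  exact Nat.add_le_add Finset.card_image_le
    (Finset.card_image_le.trans (card_touchingPairs_le n t ht))

/-- The Gilbert-Varshamov bound. -/
lemma pow_le_maxCodeSize_mul {q : ℕ} (hq : 0 < q) {t : ℕ} (ht : 1 ≤ t) (n : ℕ) :
    q ^ n ≤ maxCodeSize q n t * ((smallSets n (2 * t)).card +
      2 * n * ((n + 1) ^ (t - 1) * (n + 1) ^ (t - 1))) := by
  classical
  obtain ⟨C, hne, hC, hcard⟩ := exists_card_eq_maxCodeSize hq n t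
  have hcover : (Finset.univ : Finset (Fin n → Fin q)) ⊆ C.biUnion fun c => confusable c t := by
    intro x _
    by_contra hx
    have hx' : ∀ c ∈ C, outputs c t ∩ outputs x t = ∅ := by
      intro c hc
      by_contra h
      exact hx (Finset.mem_biUnion.2 ⟨c, hc, Finset.mem_filter.2
        ⟨Finset.mem_univ _, Set.nonempty_iff_ne_empty.2 h⟩⟩)
    have hxC : x ∉ C := fun h =>
      (Set.eq_empty_iff_forall_notMem.1 (hx' x h)) x ⟨self_mem_outputs x t, self_mem_outputs x t⟩
    -- An uncovered string could be added to the code, contradicting maximality.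
    have hcor : Corrects (insert x C) t := by
      intro u hu v hv huv
      rcases Finset.mem_insert.1 hu with rfl | hu' <;> rcases Finset.mem_insert.1 hv with rfl | hv'
      · exact absurd rfl huv
      · rw [Set.inter_comm]; exact hx' v hv'
      · exact hx' u hu'
      · exact hC u hu' v hv' huv
    have := card_le_maxCodeSize (Finset.insert_nonempty x C) hcor
    rw [Finset.card_insert_of_notMem hxC] at this
    omega
  have h1 := Finset.card_le_card hcover
  simp only [Finset.card_univ, Fintype.card_pi, Fintype.card_fin, Finset.prod_const] at h1
  rw [← hcard]
  exact h1.trans (Finset.card_biUnion_le_card_mul _ _ _ fun c _ => card_confusable_le ht c)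

theorem asympLE_gilbertVarshamov {q t : ℕ} (hq : 2 ≤ q) (ht : 1 ≤ t) :
    AsympLE
      (fun n => ((2 * t).factorial : ℝ) * (q : ℝ) ^ n /
        ((4 * (t : ℝ) / 3 + 1) * (n : ℝ) ^ (2 * t)))
      (fun n => (maxCodeSize q n t : ℝ)) := by
  refine asympLE_of_forall_eventually
    (Eventually.of_forall fun n => by exact_mod_cast maxCodeSize_pos (by omega) n t)
    fun η hη => ?_
  obtain ⟨m, hm⟩ : ∃ m, 2 * t = m + 1 := ⟨2 * t - 1, by omega⟩
  have hfac : (0 : ℝ) < (2 * t).factorial := by positivity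
  have ht1 : (1 : ℝ) ≤ t := by exact_mod_cast ht
  have hlarge : ∀ᶠ n : ℕ in atTop, 3 * 2 ^ m * ((2 * t).factorial : ℝ) ≤ n :=
    tendsto_natCast_atTop_atTop.eventually_ge_atTop _
  filter_upwards [hlarge, eventually_ge_atTop 1] with n hn hn1
  have hn1' : (1 : ℝ) ≤ n := by exact_mod_cast hn1
  have hM := maxCodeSize_pos (by omega : 0 < q) n t
  have hM' : (0 : ℝ) < maxCodeSize q n t := by exact_mod_cast hM
  have h1 : (q : ℝ) ^ n ≤ maxCodeSize q n t * ((smallSets n (2 * t)).card +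
      2 * n * ((n + 1) ^ (t - 1) * (n + 1) ^ (t - 1))) := by
    exact_mod_cast pow_le_maxCodeSize_mul (by omega : 0 < q) ht n
  have h2 := card_smallSets_succ_le n m
  rw [← hm] at h2
  have h3 : 2 * (n : ℝ) * ((n + 1) ^ (t - 1) * (n + 1) ^ (t - 1)) ≤ 2 * (n + 1) ^ m := by
    have : m = 1 + ((t - 1) + (t - 1)) := by omega
    rw [this, pow_add, pow_add, pow_one]
    have : (0 : ℝ) ≤ (n + 1) ^ (t - 1) * (n + 1) ^ (t - 1) := by positivity
    nlinarith
  have h4 : (n + 1 : ℝ) ^ m ≤ 2 ^ m * (n : ℝ) ^ m := by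
    rw [← mul_pow]
    gcongr
    linarith
  -- The lower-order terms are absorbed into one further copy of n^(2t)/(2t)!. This suffices because
  -- 4t/3 + 1 ≥ 7/3 > 2.
  have h5 : 3 * (2 ^ m * (n : ℝ) ^ m) ≤ (n : ℝ) ^ (2 * t) / (2 * t).factorial := by
    rw [le_div_iff₀ hfac, hm, pow_succ, ← hm]
    have : (0 : ℝ) ≤ (n : ℝ) ^ m := by positivity
    nlinarith
  have h6 : (q : ℝ) ^ n ≤ maxCodeSize q n t *
      ((4 * (t : ℝ) / 3 + 1) * (n : ℝ) ^ (2 * t) / (2 * t).factorial) := by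
    refine h1.trans (mul_le_mul_of_nonneg_left ?_ hM'.le)
    have : 0 ≤ (n : ℝ) ^ (2 * t) / (2 * t).factorial := by positivity
    rw [mul_div_assoc]
    nlinarith
  have h7 : ((2 * t).factorial : ℝ) * (q : ℝ) ^ n / ((4 * (t : ℝ) / 3 + 1) * (n : ℝ) ^ (2 * t)) ≤
      maxCodeSize q n t := by
    rw [div_le_iff₀ (by positivity)]
    rw [mul_div_assoc', le_div_iff₀ hfac] at h6
    linarith
  refine h7.trans ?_
  nlinarith

/-! ### Breaks and the packing bound -/

open Classical in
/-- The locations at which a transposition changes `x`. -/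
noncomputable def breaks {n q : ℕ} (x : Fin n → Fin q) : Finset ℕ :=
  (Finset.range n).filter fun k =>
    ∃ h : k + 1 < n, x ⟨k, Nat.lt_of_succ_lt h⟩ ≠ x ⟨k + 1, h⟩

lemma mem_breaks {n q : ℕ} {x : Fin n → Fin q} {k : ℕ} :
    k ∈ breaks x ↔ ∃ h : k + 1 < n, x ⟨k, Nat.lt_of_succ_lt h⟩ ≠ x ⟨k + 1, h⟩ := by
  simp only [breaks, Finset.mem_filter, Finset.mem_range, and_iff_right_iff_imp]
  rintro ⟨h, -⟩
  omega

/-- At the first location `k` where the patterns differ, say `k ∈ K`, the other pattern cannot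
contain `k - 1` either, since `K` would then contain both. One output has x_(k+1) at `k` and the
other x_k, and these differ at a break. -/
lemma eq_of_transpose_eq {n q : ℕ} {x : Fin n → Fin q} {K K' : Finset ℕ} (hK : IsPattern n K)
    (hK' : IsPattern n K') (hb : K ⊆ breaks x) (hb' : K' ⊆ breaks x)
    (h : transpose K x = transpose K' x) : K = K' := by
  have step : ∀ {K K' : Finset ℕ} {k : ℕ}, IsPattern n K → IsPattern n K' → K ⊆ breaks x →
      transpose K x = transpose K' x → (∀ m < k, m ∈ K ↔ m ∈ K') → k ∈ K → k ∈ K' := by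
    intro K K' k hK hK' hb h ih hk
    obtain ⟨hlt, hne⟩ := mem_breaks.1 (hb hk)
    by_contra hk'
    have h1 := congrFun h ⟨k, Nat.lt_of_succ_lt hlt⟩
    rw [hK.transpose_apply, hK'.transpose_apply] at h1
    have e1 : swapIdx K k = k + 1 := by simp [swapIdx, hk]
    simp only [e1] at h1
    by_cases h2 : 1 ≤ k ∧ k - 1 ∈ K'
    · have h3 := (ih (k - 1) (by omega)).2 h2.2
      have := hK.2 _ h3 _ hk (by omega)
      omega
    · have e2 : swapIdx K' k = k := by simp [swapIdx, hk', h2]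
      simp only [e2] at h1
      exact hne h1.symm
  ext k
  induction k using Nat.strong_induction_on with
  | _ k ih =>
    exact ⟨step hK hK' hb h ih, step hK' hK hb' h.symm fun m hm => (ih m hm).symm⟩

open Classical in
/-- The transposition patterns with `s` locations in `R`. -/
noncomputable def patternsIn (n : ℕ) (R : Finset ℕ) (s : ℕ) : Finset (Finset ℕ) :=
  (R.powersetCard s).filter (IsPattern n)

lemma mem_patternsIn {n s : ℕ} {R K : Finset ℕ} :
    K ∈ patternsIn n R s ↔ K ⊆ R ∧ K.card = s ∧ IsPattern n K := by
  simp [patternsIn, Finset.mem_powersetCard, and_assoc]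

/-- Double counting of inclusions. Each location of a pattern blocks at most three positions for an
additional one, and a pattern of s+1 locations contains at most s+1 patterns of size s. -/
lemma card_patternsIn_mul_le {n : ℕ} {R : Finset ℕ} (hR : ∀ k ∈ R, k + 1 < n) (s : ℕ) :
    (patternsIn n R s).card * (R.card - 3 * s) ≤ (patternsIn n R (s + 1)).card * (s + 1) := by
  classical
  refine Finset.card_mul_le_card_mul (fun K K' : Finset ℕ => K ⊆ K') (fun K hK => ?_)
    (fun K' hK' => ?_)
  · obtain ⟨h1, h2, h3⟩ := mem_patternsIn.1 hK
    -- Truncated subtraction sends 0 to 0, which is harmless because that point already lies in `K`.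
    set N := K ∪ K.image (· + 1) ∪ K.image (· - 1) with hN
    have hNcard : N.card ≤ 3 * s := by
      calc N.card ≤ (K ∪ K.image (· + 1)).card + (K.image (· - 1)).card := Finset.card_union_le _ _
        _ ≤ K.card + (K.image (· + 1)).card + (K.image (· - 1)).card := by
          gcongr; exact Finset.card_union_le _ _
        _ ≤ K.card + K.card + K.card :=
          Nat.add_le_add (Nat.add_le_add_left Finset.card_image_le _) Finset.card_image_le
        _ = 3 * s := by omega
    have hmem : ∀ k ∈ R \ N, k ∉ K ∧ ∀ j ∈ K, j ≠ k + 1 ∧ k ≠ j + 1 := by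
      intro k hk
      have hkN := (Finset.mem_sdiff.1 hk).2
      simp only [hN, Finset.mem_union, Finset.mem_image, not_or, not_exists, not_and] at hkN
      refine ⟨hkN.1.1, fun j hj => ⟨fun h => hkN.2 j hj (by omega), fun h => ?_⟩⟩
      exact hkN.1.2 j hj h.symm
    calc R.card - 3 * s ≤ R.card - N.card := Nat.sub_le_sub_left hNcard _
      _ ≤ (R \ N).card := Finset.le_card_sdiff _ _
      _ = ((R \ N).image (insert · K)).card := by
        refine (Finset.card_image_of_injOn fun a ha b hb hab => ?_).symm
        have haK := (hmem a ha).1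
        have : a ∈ insert b K := by
          have h : insert a K = insert b K := hab
          rw [← h]; exact Finset.mem_insert_self _ _
        exact (Finset.mem_insert.1 this).resolve_right haK
      _ ≤ _ := by
        refine Finset.card_le_card fun K' hK' => ?_
        obtain ⟨k, hk, rfl⟩ := Finset.mem_image.1 hK'
        have hkR := (Finset.mem_sdiff.1 hk).1
        obtain ⟨hkK, hadj⟩ := hmem k hk
        refine (Finset.mem_bipartiteAbove _).2 ⟨mem_patternsIn.2 ⟨?_, ?_, ?_, ?_⟩,
          Finset.subset_insert _ _⟩
        · exact Finset.insert_subset hkR h1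
        · rw [Finset.card_insert_of_notMem hkK, h2]
        · intro m hm
          rcases Finset.mem_insert.1 hm with rfl | hm
          · exact hR _ hkR
          · exact h3.1 m hm
        · intro i hi j hj hij
          rcases Finset.mem_insert.1 hi with hi | hi <;> rcases Finset.mem_insert.1 hj with hj | hj
          · omega
          · have := (hadj j hj).1; omega
          · have := (hadj i hi).2; omega
          · exact h3.2 i hi j hj hij
  · obtain ⟨h1, h2, h3⟩ := mem_patternsIn.1 hK'
    calc _ ≤ (K'.powersetCard s).card := by
          refine Finset.card_le_card fun K hK => ?_
          obtain ⟨hK1, hK2⟩ := (Finset.mem_bipartiteBelow _).1 hK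
          exact Finset.mem_powersetCard.2 ⟨hK2, (mem_patternsIn.1 hK1).2.1⟩
      _ = s + 1 := by rw [Finset.card_powersetCard, h2, Nat.choose_succ_self_right]

lemma pow_le_card_patternsIn {n : ℕ} {R : Finset ℕ} (hR : ∀ k ∈ R, k + 1 < n) (t : ℕ) :
    (R.card - 3 * t) ^ t ≤ (patternsIn n R t).card * t.factorial := by
  have h : ∀ s ≤ t, (R.card - 3 * t) ^ s ≤ (patternsIn n R s).card * s.factorial := by
    intro s
    induction s with
    | zero =>
      intro _
      have : (∅ : Finset ℕ) ∈ patternsIn n R 0 := mem_patternsIn.2 ⟨by simp, by simp, by simp [IsPattern]⟩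
      simpa using Finset.card_pos.2 ⟨_, this⟩
    | succ s ih =>
      intro hs
      calc (R.card - 3 * t) ^ (s + 1) = (R.card - 3 * t) ^ s * (R.card - 3 * t) := pow_succ _ _
        _ ≤ (patternsIn n R s).card * s.factorial * (R.card - 3 * s) :=
          Nat.mul_le_mul (ih (by omega)) (by omega)
        _ = (patternsIn n R s).card * (R.card - 3 * s) * s.factorial := by ring
        _ ≤ (patternsIn n R (s + 1)).card * (s + 1) * s.factorial :=
          Nat.mul_le_mul_right _ (card_patternsIn_mul_le hR s)
        _ = _ := by rw [Nat.factorial_succ]; ring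
  exact h t le_rfl

/-- The packing bound for strings with many breaks. -/
lemma card_mul_pow_le {n q t r : ℕ} {C : Finset (Fin n → Fin q)} (hC : Corrects C t)
    (hr : ∀ x ∈ C, r ≤ (breaks x).card) : C.card * (r - 3 * t) ^ t ≤ q ^ n * t.factorial := by
  classical
  set f : (Fin n → Fin q) → Finset (Fin n → Fin q) := fun x =>
    (patternsIn n (breaks x) t).image fun K => transpose K x with hf
  have hfcard : ∀ x, (f x).card = (patternsIn n (breaks x) t).card := by
    intro x
    refine Finset.card_image_of_injOn fun K hK K' hK' h => ?_
    obtain ⟨a1, -, a3⟩ := mem_patternsIn.1 hK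
    obtain ⟨b1, -, b3⟩ := mem_patternsIn.1 hK'
    exact eq_of_transpose_eq a3 b3 a1 b1 h
  have hfout : ∀ x, ∀ y ∈ f x, y ∈ outputs x t := by
    intro x y hy
    obtain ⟨K, hK, rfl⟩ := Finset.mem_image.1 hy
    obtain ⟨-, a2, a3⟩ := mem_patternsIn.1 hK
    exact mem_outputs_iff.2 ⟨K, a3, a2.le, rfl⟩
  have hdisj : (C : Set (Fin n → Fin q)).PairwiseDisjoint f := by
    intro x hx x' hx' hne
    refine Finset.disjoint_left.2 fun y hy hy' => ?_
    exact (Set.eq_empty_iff_forall_notMem.1 (hC x hx x' hx' hne)) y ⟨hfout _ _ hy, hfout _ _ hy'⟩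
  have h1 : ∑ x ∈ C, (f x).card ≤ q ^ n := by
    rw [← Finset.card_biUnion hdisj]
    refine (Finset.card_le_univ _).trans_eq ?_
    simp
  calc C.card * (r - 3 * t) ^ t = ∑ x ∈ C, (r - 3 * t) ^ t := by simp
    _ ≤ ∑ x ∈ C, (f x).card * t.factorial := by
      refine Finset.sum_le_sum fun x hx => ?_
      rw [hfcard]
      refine le_trans (Nat.pow_le_pow_left (Nat.sub_le_sub_right (hr x hx) _) _)
        (pow_le_card_patternsIn (fun k hk => (mem_breaks.1 hk).1) t)
    _ = (∑ x ∈ C, (f x).card) * t.factorial := (Finset.sum_mul _ _ _).symm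
    _ ≤ _ := Nat.mul_le_mul_right _ h1

lemma pow_card_breaks {n q : ℕ} (x : Fin (n + 1) → Fin q) (z : ℝ) :
    z ^ (breaks x).card = ∏ k : Fin n, if x k.castSucc = x k.succ then 1 else z := by
  classical
  have h : breaks x = ((Finset.univ : Finset (Fin n)).filter
      fun k => ¬ x k.castSucc = x k.succ).image Fin.val := by
    ext k
    rw [mem_breaks]
    simp only [Finset.mem_image, Finset.mem_filter, Finset.mem_univ, true_and]
    constructor
    · rintro ⟨h, hne⟩
      exact ⟨⟨k, by omega⟩, hne, rfl⟩
    · rintro ⟨j, hne, rfl⟩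
      exact ⟨by have := j.2; omega, hne⟩
  rw [h, Finset.card_image_of_injective _ Fin.val_injective, Finset.prod_ite]
  simp

/-- Prepend symbols one at a time: one choice repeats the next symbol and the other q - 1 create a
break. -/
lemma sum_pow_card_breaks (n : ℕ) {q : ℕ} (hq : 1 ≤ q) (z : ℝ) :
    ∑ x : Fin (n + 1) → Fin q, z ^ (breaks x).card = q * (1 + (q - 1) * z) ^ n := by
  simp_rw [pow_card_breaks]
  induction n with
  | zero => simp
  | succ n ih =>
    rw [← (Fin.consEquiv fun _ : Fin (n + 2) => Fin q).sum_comp, Fintype.sum_prod_type_right,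
      pow_succ, ← mul_assoc, ← ih, Finset.sum_mul]
    refine Finset.sum_congr rfl fun y _ => ?_
    have h1 : ∀ a : Fin q, (∏ k : Fin (n + 1),
        if (Fin.consEquiv fun _ : Fin (n + 2) => Fin q) (a, y) k.castSucc =
          (Fin.consEquiv fun _ : Fin (n + 2) => Fin q) (a, y) k.succ then (1 : ℝ) else z) =
        (if a = y 0 then 1 else z) * ∏ k : Fin n, if y k.castSucc = y k.succ then 1 else z := by
      intro a
      rw [Fin.prod_univ_succ]
      simp [Fin.consEquiv]
    simp_rw [h1]
    rw [← Finset.sum_mul, mul_comm]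
    congr 1
    rw [Finset.sum_ite]
    simp [Finset.filter_eq', Finset.filter_ne', Finset.card_erase_of_mem, Nat.cast_sub hq]

/-- Few strings have substantially fewer breaks than a random one. -/
lemma card_filter_breaks_lt_le {n q : ℕ} (hn : 1 ≤ n) (hq : 2 ≤ q) {s : ℝ} (hs : 0 < s)
    (hs1 : s ≤ 1) :
    (((Finset.univ : Finset (Fin n → Fin q)).filter fun x =>
      ((breaks x).card : ℝ) < (1 - 2 * s) * (((q : ℝ) - 1) / q) * n).card : ℝ) ≤
      (q : ℝ) ^ n * Real.exp (1 - ((q : ℝ) - 1) / q * s ^ 2 * n) := by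
  obtain ⟨m, rfl⟩ : ∃ m, n = m + 1 := ⟨n - 1, by omega⟩
  have hq2 : (2 : ℝ) ≤ q := by exact_mod_cast hq
  set P : ℝ := ((q : ℝ) - 1) / q with hP
  have hP0 : 0 < P := div_pos (by linarith) (by linarith)
  have hP1 : P ≤ 1 := by rw [hP, div_le_one (by linarith)]; linarith
  set B := (Finset.univ : Finset (Fin (m + 1) → Fin q)).filter fun x =>
    ((breaks x).card : ℝ) < (1 - 2 * s) * P * ((m + 1 : ℕ) : ℝ) with hB
  set z := Real.exp (-s) with hz
  -- Chernoff's method with weight z = e^(-s) per break; this bounds the gain per adjacent pair to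
  -- second order in `s`.
  have hz1 : 1 - z ≥ s * (1 - s) := by
    have h1 : z ≤ (1 + s)⁻¹ := by
      rw [hz, Real.exp_neg]
      refine inv_anti₀ (by linarith) ?_
      linarith [Real.add_one_le_exp s]
    have h2 : (1 + s)⁻¹ ≤ 1 - s * (1 - s) := by
      rw [inv_le_iff_one_le_mul₀ (by linarith)]
      nlinarith [pow_pos hs 3]
    linarith
  have h1 : (B.card : ℝ) * Real.exp (-s * ((1 - 2 * s) * P * ((m + 1 : ℕ) : ℝ))) ≤
      q * (1 + (q - 1) * z) ^ m := by
    rw [← sum_pow_card_breaks m (by omega) z, ← nsmul_eq_mul, ← Finset.sum_const]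
    refine (Finset.sum_le_sum fun x hx => ?_).trans
      (Finset.sum_le_univ_sum_of_nonneg fun x => by positivity)
    rw [hz, ← Real.exp_nat_mul, Real.exp_le_exp]
    have := (Finset.mem_filter.1 hx).2
    nlinarith
  have h2 : 1 + ((q : ℝ) - 1) * z ≤ q * Real.exp (-P * (s * (1 - s))) := by
    have h3 : 1 + ((q : ℝ) - 1) * z = q * (1 - P * (1 - z)) := by
      rw [hP]; field_simp; ring
    rw [h3]
    refine mul_le_mul_of_nonneg_left ?_ (by linarith)
    have := Real.add_one_le_exp (-P * (s * (1 - s)))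
    nlinarith
  have h4 : (q : ℝ) * (1 + (q - 1) * z) ^ m ≤
      (q : ℝ) ^ (m + 1) * Real.exp (m * (-P * (s * (1 - s)))) := by
    have h0 : 0 ≤ 1 + ((q : ℝ) - 1) * z := by
      have : 0 < z := Real.exp_pos _
      nlinarith
    calc (q : ℝ) * (1 + (q - 1) * z) ^ m ≤ q * (q * Real.exp (-P * (s * (1 - s)))) ^ m := by
          gcongr
      _ = _ := by rw [mul_pow, ← Real.exp_nat_mul]; ring
  have h5 : (B.card : ℝ) = B.card * Real.exp (-s * ((1 - 2 * s) * P * ((m + 1 : ℕ) : ℝ))) *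
      Real.exp (s * ((1 - 2 * s) * P * ((m + 1 : ℕ) : ℝ))) := by
    rw [mul_assoc, ← Real.exp_add, neg_mul, neg_add_cancel, Real.exp_zero, mul_one]
  rw [h5]
  calc _ ≤ (q : ℝ) ^ (m + 1) * Real.exp (m * (-P * (s * (1 - s)))) *
        Real.exp (s * ((1 - 2 * s) * P * ((m + 1 : ℕ) : ℝ))) := by
        exact mul_le_mul_of_nonneg_right (h1.trans h4) (Real.exp_pos _).le
    _ = (q : ℝ) ^ (m + 1) * Real.exp (m * (-P * (s * (1 - s))) +
        s * ((1 - 2 * s) * P * ((m + 1 : ℕ) : ℝ))) := by rw [mul_assoc, Real.exp_add]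
    _ ≤ _ := by
      gcongr
      push_cast
      -- A string of length m+1 has only m adjacent pairs; the constant 1 in the exponent pays for
      -- the missing one.
      have : P * (s * (1 - s)) ≤ 1 := by
        have a1 : s * (1 - s) ≤ 1 := by nlinarith
        have a2 : 0 ≤ s * (1 - s) := mul_nonneg hs.le (by linarith)
        nlinarith
      nlinarith

lemma tendsto_pow_mul_exp_neg {c : ℝ} (hc : 0 < c) (t : ℕ) (d : ℝ) :
    Tendsto (fun n : ℕ => (n : ℝ) ^ t * Real.exp (d - c * n)) atTop (𝓝 0) := by
  have h := (Real.tendsto_pow_mul_exp_neg_atTop_nhds_zero t).comp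
    ((tendsto_natCast_atTop_atTop (R := ℝ)).const_mul_atTop hc)
  have h2 := h.const_mul (Real.exp d / c ^ t)
  rw [mul_zero] at h2
  refine h2.congr fun n => ?_
  simp only [Function.comp_apply]
  rw [sub_eq_add_neg, Real.exp_add, mul_pow]
  field_simp

theorem asympLE_packing {q t : ℕ} (hq : 2 ≤ q) :
    AsympLE
      (fun n => (maxCodeSize q n t : ℝ))
      (fun n => (t.factorial : ℝ) * (q : ℝ) ^ (n + t) / (((q : ℝ) - 1) ^ t * (n : ℝ) ^ t)) := by
  classical
  have hq2 : (2 : ℝ) ≤ q := by exact_mod_cast hq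
  have hq1 : (0 : ℝ) < (q : ℝ) - 1 := by linarith
  set P : ℝ := ((q : ℝ) - 1) / q with hP
  have hP0 : 0 < P := div_pos (by linarith) (by linarith)
  have hfac : (0 : ℝ) < t.factorial := by positivity
  have hb : ∀ n : ℕ, 1 ≤ n →
      (t.factorial : ℝ) * (q : ℝ) ^ (n + t) / (((q : ℝ) - 1) ^ t * (n : ℝ) ^ t) =
      t.factorial * (q : ℝ) ^ n / (P * n) ^ t := by
    intro n hn
    have : (0 : ℝ) < n := by exact_mod_cast hn
    rw [hP, pow_add, mul_pow, div_pow]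
    field_simp
  refine asympLE_of_forall_eventually ?_ fun η hη => ?_
  · filter_upwards [eventually_ge_atTop 1] with n hn
    have : (0 : ℝ) < n := by exact_mod_cast hn
    positivity
  obtain ⟨s, hs0, hs1, hsη⟩ : ∃ s : ℝ, 0 < s ∧ s ≤ 1 / 4 ∧ ((1 - 3 * s) ^ t)⁻¹ ≤ 1 + η / 2 := by
    have hc : ContinuousAt (fun s : ℝ => ((1 - 3 * s) ^ t)⁻¹) 0 := by
      refine ContinuousAt.inv₀ (by fun_prop) (by simp)
    have h1 : ∀ᶠ s : ℝ in 𝓝 0, ((1 - 3 * s) ^ t)⁻¹ < 1 + η / 2 :=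
      hc.eventually_lt_const (by simp; linarith)
    have h2 : ∀ᶠ s : ℝ in 𝓝[>] 0, ((1 - 3 * s) ^ t)⁻¹ < 1 + η / 2 := h1.filter_mono nhdsWithin_le_nhds
    obtain ⟨s, h3, h4⟩ := (h2.and (Ioc_mem_nhdsGT (by norm_num : (0 : ℝ) < 1 / 4))).exists
    exact ⟨s, h4.1, h4.2, h3.le⟩
  have hlarge : ∀ᶠ n : ℕ in atTop, 3 * t / (s * P) ≤ (n : ℝ) :=
    tendsto_natCast_atTop_atTop.eventually_ge_atTop _
  have htail : ∀ᶠ n : ℕ in atTop,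
      (n : ℝ) ^ t * Real.exp (1 - P * s ^ 2 * n) < η / 2 * t.factorial / P ^ t :=
    (tendsto_pow_mul_exp_neg (by positivity) t 1).eventually_lt_const (by positivity)
  filter_upwards [hlarge, htail, eventually_ge_atTop 1] with n h1 h2 hn
  rw [hb n hn]
  have hn0 : (0 : ℝ) < n := by exact_mod_cast hn
  obtain ⟨C, hne, hC, hcard⟩ := exists_card_eq_maxCodeSize (by omega : 0 < q) n t
  rw [← hcard]
  rw [← Finset.card_filter_add_card_filter_not
    (fun x => ((breaks x).card : ℝ) < (1 - 2 * s) * P * n)]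
  -- The threshold uses 1 - 2s, while `s` was chosen for 1 - 3s; the spare s·P·n covers the loss of
  -- 3t locations.
  set r := ⌈(1 - 2 * s) * P * n⌉₊ with hr
  have hgood := card_mul_pow_le (r := r) (t := t)
    (C := C.filter fun x => ¬ ((breaks x).card : ℝ) < (1 - 2 * s) * P * n)
    (fun x hx x' hx' => hC x (Finset.mem_filter.1 hx).1 x' (Finset.mem_filter.1 hx').1)
    (fun x hx => Nat.ceil_le.2 (not_lt.1 (Finset.mem_filter.1 hx).2))
  have hbad : ((C.filter fun x => ((breaks x).card : ℝ) < (1 - 2 * s) * P * n).card : ℝ) ≤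
      (q : ℝ) ^ n * Real.exp (1 - P * s ^ 2 * n) := by
    refine le_trans ?_ (card_filter_breaks_lt_le hn hq hs0 (by linarith))
    exact Nat.cast_le.2 (Finset.card_le_card (Finset.filter_subset_filter _ (Finset.subset_univ _)))
  have hr' : (1 - 3 * s) * (P * n) ≤ ((r - 3 * t : ℕ) : ℝ) := by
    have a1 : (r : ℝ) ≤ ((r - 3 * t : ℕ) : ℝ) + 3 * t := by
      have : r ≤ (r - 3 * t) + 3 * t := by omega
      exact_mod_cast this
    have a2 := Nat.le_ceil ((1 - 2 * s) * P * n)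
    rw [div_le_iff₀ (by positivity)] at h1
    nlinarith
  have h13 : 0 < 1 - 3 * s := by linarith
  have hgood' : ((C.filter fun x => ¬ ((breaks x).card : ℝ) < (1 - 2 * s) * P * n).card : ℝ) ≤
      (1 + η / 2) * (t.factorial * (q : ℝ) ^ n / (P * n) ^ t) := by
    have a1 : ((C.filter fun x => ¬ ((breaks x).card : ℝ) < (1 - 2 * s) * P * n).card : ℝ) *
        ((1 - 3 * s) * (P * n)) ^ t ≤ (q : ℝ) ^ n * t.factorial := by
      have a2 : ((C.filter fun x => ¬ ((breaks x).card : ℝ) < (1 - 2 * s) * P * n).card : ℝ) *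
          ((r - 3 * t : ℕ) : ℝ) ^ t ≤ (q : ℝ) ^ n * t.factorial := by exact_mod_cast hgood
      refine le_trans ?_ a2
      gcongr
    rw [← le_div_iff₀ (by positivity)] at a1
    refine a1.trans ?_
    calc _ = ((1 - 3 * s) ^ t)⁻¹ * (t.factorial * (q : ℝ) ^ n / (P * n) ^ t) := by
          rw [mul_pow]; field_simp
      _ ≤ _ := by gcongr
  have hbad' : (q : ℝ) ^ n * Real.exp (1 - P * s ^ 2 * n) ≤
      η / 2 * (t.factorial * (q : ℝ) ^ n / (P * n) ^ t) := by
    rw [lt_div_iff₀ (by positivity)] at h2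
    rw [mul_div_assoc', le_div_iff₀ (by positivity), mul_pow]
    calc _ = (q : ℝ) ^ n * ((n : ℝ) ^ t * Real.exp (1 - P * s ^ 2 * n) * P ^ t) := by ring
      _ ≤ (q : ℝ) ^ n * (η / 2 * t.factorial) := by gcongr
      _ = _ := by ring
  push_cast
  linarith

/-! ### Prefix counts and syndromes of binary strings -/

/-- The symbol at position `j` as a natural number, `0` beyond the end of the string. -/
def symbolAt {n : ℕ} (x : Fin n → Fin 2) (j : ℕ) : ℕ := if h : j < n then x ⟨j, h⟩ else 0

/-- The number of ones among the first `m` symbols. -/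
def ones {n : ℕ} (x : Fin n → Fin 2) (m : ℕ) : ℕ := ∑ j ∈ Finset.range m, symbolAt x j

lemma symbolAt_le {n : ℕ} (x : Fin n → Fin 2) (j : ℕ) : symbolAt x j ≤ 1 := by
  unfold symbolAt
  split_ifs with h
  · have := (x ⟨j, h⟩).2; omega
  · omega

lemma symbolAt_injective {n : ℕ} {x x' : Fin n → Fin 2} (h : ∀ j, symbolAt x j = symbolAt x' j) :
    x = x' := by
  ext i
  simpa [symbolAt] using h i

lemma ones_succ {n : ℕ} (x : Fin n → Fin 2) (m : ℕ) : ones x (m + 1) = ones x m + symbolAt x m :=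
  Finset.sum_range_succ _ _

lemma ones_mono {n : ℕ} (x : Fin n → Fin 2) : Monotone (ones x) :=
  monotone_nat_of_le_succ fun m => by rw [ones_succ]; omega

lemma IsPattern.symbolAt_transpose {n : ℕ} {K : Finset ℕ} (hK : IsPattern n K)
    (y : Fin n → Fin 2) (j : ℕ) : symbolAt (transpose K y) j = symbolAt y (swapIdx K j) := by
  by_cases h : j < n
  · simp [symbolAt, h, hK.swapIdx_lt h, hK.transpose_apply]
  · have h1 : j ∉ K := fun hj => by have := hK.1 j hj; omega
    have h2 : ¬ (1 ≤ j ∧ j - 1 ∈ K) := fun hj => by have := hK.1 _ hj.2; omega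
    simp [symbolAt, h, swapIdx, h1, h2]

/-- A swap at `k` affects only the prefix of length k+1; every other prefix contains both swapped
symbols or neither. -/
lemma IsPattern.ones_transpose {n : ℕ} {K : Finset ℕ} (hK : IsPattern n K)
    (y : Fin n → Fin 2) (m : ℕ) : ones (transpose K y) m =
      if 1 ≤ m ∧ m - 1 ∈ K then ones y (m - 1) + symbolAt y m else ones y m := by
  induction m with
  | zero => simp [ones]
  | succ m ih =>
    rw [ones_succ, ih, hK.symbolAt_transpose]
    simp only [Nat.add_sub_cancel, Nat.le_add_left, true_and]
    by_cases h1 : m ∈ K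
    · have h2 : ¬ (1 ≤ m ∧ m - 1 ∈ K) := fun h => by
        have := hK.2 _ h.2 m h1 (by omega); omega
      simp [h1, h2, swapIdx]
    · by_cases h2 : 1 ≤ m ∧ m - 1 ∈ K
      · obtain ⟨j, rfl⟩ : ∃ j, m = j + 1 := ⟨m - 1, by omega⟩
        have h3 : j ∈ K := by simpa using h2
        simp [h1, h3, swapIdx, ones_succ]
        omega
      · simp [h1, h2, swapIdx, ones_succ]

lemma IsPattern.ones_transpose_length {n : ℕ} {K : Finset ℕ} (hK : IsPattern n K)
    (y : Fin n → Fin 2) : ones (transpose K y) n = ones y n := by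
  rw [hK.ones_transpose, if_neg]
  rintro ⟨h1, h2⟩
  have := hK.1 _ h2
  omega

/-- The locations in `K` that carry the pattern `01`. -/
def ups {n : ℕ} (K : Finset ℕ) (y : Fin n → Fin 2) : Finset ℕ :=
  K.filter fun k => symbolAt y k = 0 ∧ symbolAt y (k + 1) = 1

/-- The locations in `K` that carry the pattern `10`. -/
def downs {n : ℕ} (K : Finset ℕ) (y : Fin n → Fin 2) : Finset ℕ :=
  K.filter fun k => symbolAt y k = 1 ∧ symbolAt y (k + 1) = 0

/-- Swapping equal symbols does nothing, so only the effective locations need to be recovered when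
decoding. -/
lemma IsPattern.transpose_ups_union_downs {n : ℕ} {K : Finset ℕ} (hK : IsPattern n K)
    (y : Fin n → Fin 2) : transpose (ups K y ∪ downs K y) y = transpose K y := by
  have hsub : ups K y ∪ downs K y ⊆ K :=
    Finset.union_subset (Finset.filter_subset _ _) (Finset.filter_subset _ _)
  have hmem : ∀ k, k ∈ ups K y ∪ downs K y ↔ k ∈ K ∧ symbolAt y k ≠ symbolAt y (k + 1) := by
    intro k
    have h1 := symbolAt_le y k
    have h2 := symbolAt_le y (k + 1)
    simp only [ups, downs, Finset.mem_union, Finset.mem_filter]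
    constructor
    · rintro (⟨h, h'⟩ | ⟨h, h'⟩) <;> exact ⟨h, by omega⟩
    · rintro ⟨h, h'⟩
      rcases Nat.lt_or_gt_of_ne h' with h3 | h3
      · exact Or.inl ⟨h, by omega, by omega⟩
      · exact Or.inr ⟨h, by omega, by omega⟩
  refine symbolAt_injective fun j => ?_
  rw [hK.symbolAt_transpose, (hK.mono hsub).symbolAt_transpose]
  unfold swapIdx
  simp only [hmem]
  by_cases h1 : j ∈ K
  · have h2 : ¬ (1 ≤ j ∧ j - 1 ∈ K) := fun h => by
      have := hK.2 _ h.2 j h1 (by omega); omega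
    by_cases h3 : symbolAt y j = symbolAt y (j + 1)
    · have h4 : ¬ (1 ≤ j ∧ j - 1 ∈ K ∧ symbolAt y (j - 1) ≠ symbolAt y (j - 1 + 1)) :=
        fun h => h2 ⟨h.1, h.2.1⟩
      simp only [h3, ne_eq, not_true_eq_false, and_false, if_false, if_pos h1, if_neg h4]
    · simp [h1, h3]
  · by_cases h2 : 1 ≤ j ∧ j - 1 ∈ K
    · have h5 : j - 1 + 1 = j := by omega
      by_cases h3 : symbolAt y (j - 1) = symbolAt y j
      · simp [h1, h2, h3, h5]
      · simp [h1, h2, h3, h5]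
    · have h4 : ¬ (1 ≤ j ∧ j - 1 ∈ K ∧ symbolAt y (j - 1) ≠ symbolAt y (j - 1 + 1)) :=
        fun h => h2 ⟨h.1, h.2.1⟩
      rw [if_neg (fun h => h1 h.1), if_neg h4, if_neg h1, if_neg h2]

/-- Signed sums of at most `t` of the elements `b 0, …, b (W - 1)` are pairwise distinct. -/
def SignedInjective {G : Type*} [AddCommGroup G] (b : ℕ → G) (W t : ℕ) : Prop :=
  ∀ A B A' B' : Finset ℕ, A ⊆ Finset.range W → B ⊆ Finset.range W → A' ⊆ Finset.range W →
    B' ⊆ Finset.range W → Disjoint A B → Disjoint A' B' → A.card + B.card ≤ t →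
    A'.card + B'.card ≤ t →
    ∑ j ∈ A, b j - ∑ j ∈ B, b j = ∑ j ∈ A', b j - ∑ j ∈ B', b j → A = A' ∧ B = B'

section Syndrome

variable {G : Type*} [AddCommGroup G]

/-- The syndrome of a binary string with respect to a sequence in an abelian group. -/
def syndrome {n : ℕ} (b : ℕ → G) (x : Fin n → Fin 2) : G :=
  ∑ m ∈ Finset.range n, ∑ j ∈ Finset.range (ones x m), b j

lemma ones_lt_of_up {n : ℕ} {y : Fin n → Fin 2} {k k' : ℕ} (h1 : symbolAt y (k + 1) = 1)
    (h' : symbolAt y k' = 0 ∨ k + 2 ≤ k') (hk : k < k') : ones y k < ones y k' := by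
  have hle : k + 2 ≤ k' := by
    rcases h' with h' | h'
    · have : k' ≠ k + 1 := by rintro rfl; omega
      omega
    · exact h'
  have h2 := ones_mono y hle
  have h3 := ones_succ y (k + 1)
  have h4 := ones_succ y k
  simp only [Nat.add_assoc, Nat.reduceAdd] at h3 h4
  omega

lemma ones_lt_of_down {n : ℕ} {y : Fin n → Fin 2} {k k' : ℕ} (h1 : symbolAt y k = 1)
    (hk : k < k') : ones y k < ones y k' := by
  have h2 := ones_mono y (Nat.succ_le_of_lt hk)
  have h3 := ones_succ y k
  simp only [Nat.succ_eq_add_one] at h2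
  omega

/-- Each effective pair contains a one, and the pairs of a pattern are disjoint, so the number of
preceding ones strictly increases from one pair to the next. -/
lemma IsPattern.ones_injOn {n : ℕ} {K : Finset ℕ} (hK : IsPattern n K) (y : Fin n → Fin 2) :
    Set.InjOn (ones y) (ups K y ∪ downs K y : Finset ℕ) := by
  have key : ∀ k ∈ ups K y ∪ downs K y, ∀ k' ∈ ups K y ∪ downs K y, k < k' →
      ones y k < ones y k' := by
    intro k hk k' hk' hlt
    have hk'K : k' ∈ K := by
      rcases Finset.mem_union.1 hk' with h | h <;> exact (Finset.mem_filter.1 h).1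
    rcases Finset.mem_union.1 hk with h | h
    · obtain ⟨h1, h2, h3⟩ := Finset.mem_filter.1 h
      exact ones_lt_of_up h3 (Or.inr (hK.2 k h1 k' hk'K hlt)) hlt
    · exact ones_lt_of_down (Finset.mem_filter.1 h).2.1 hlt
  intro k hk k' hk' h
  rcases lt_trichotomy k k' with hlt | heq | hlt
  · exact absurd h (key k hk k' hk' hlt).ne
  · exact heq
  · exact absurd h (key k' hk' k hk hlt).ne'

/-- With r ones before `k`, swapping 01 raises the prefix count at k+1 from r to r+1 and adds b_r;
swapping 10 lowers it from r+1 to r and removes b_r. -/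
lemma IsPattern.syndrome_transpose {n : ℕ} {K : Finset ℕ} (hK : IsPattern n K) (b : ℕ → G)
    (y : Fin n → Fin 2) : syndrome b (transpose K y) = syndrome b y +
      (∑ j ∈ (ups K y).image (ones y), b j - ∑ j ∈ (downs K y).image (ones y), b j) := by
  have hinj := hK.ones_injOn y
  rw [Finset.sum_image (hinj.mono (by exact_mod_cast Finset.subset_union_left)),
    Finset.sum_image (hinj.mono (by exact_mod_cast Finset.subset_union_right)),
    ← sub_eq_iff_eq_add']
  unfold syndrome
  rw [← Finset.sum_sub_distrib]
  have hsub : K.image (· + 1) ⊆ Finset.range n := by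
    intro m hm
    obtain ⟨k, hk, rfl⟩ := Finset.mem_image.1 hm
    exact Finset.mem_range.2 (hK.1 k hk)
  rw [← Finset.sum_subset hsub, Finset.sum_image (fun _ _ _ _ h => by simpa using h)]
  · rw [ups, downs, Finset.sum_filter, Finset.sum_filter, ← Finset.sum_sub_distrib]
    refine Finset.sum_congr rfl fun k hk => ?_
    rw [hK.ones_transpose]
    simp only [Nat.add_sub_cancel, Nat.le_add_left, true_and, hk, if_true]
    rw [ones_succ]
    have h1 := symbolAt_le y k
    have h2 := symbolAt_le y (k + 1)
    interval_cases symbolAt y k <;> interval_cases symbolAt y (k + 1) <;>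
      simp [Finset.sum_range_succ]
  · intro m _ hm
    rw [hK.ones_transpose, if_neg, sub_self]
    rintro ⟨h1, h2⟩
    exact hm (Finset.mem_image.2 ⟨m - 1, h2, by omega⟩)

lemma image_ones_subset {n W : ℕ} {K : Finset ℕ} (hK : IsPattern n K) {y : Fin n → Fin 2}
    (hW : ones y n ≤ W) {U : Finset ℕ} (hU : U ⊆ ups K y ∪ downs K y) :
    U.image (ones y) ⊆ Finset.range W := by
  intro r hr
  obtain ⟨k, hk, rfl⟩ := Finset.mem_image.1 hr
  refine Finset.mem_range.2 (lt_of_lt_of_le ?_ hW)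
  rcases Finset.mem_union.1 (hU hk) with h | h
  · obtain ⟨h1, h2, h3⟩ := Finset.mem_filter.1 h
    have := hK.1 k h1
    exact ones_lt_of_up h3 (Or.inr (by omega)) (by omega)
  · obtain ⟨h1, h2, h3⟩ := Finset.mem_filter.1 h
    have := hK.1 k h1
    exact ones_lt_of_down h2 (by omega)

lemma disjoint_ups_downs {n : ℕ} (K : Finset ℕ) (y : Fin n → Fin 2) :
    Disjoint (ups K y) (downs K y) := by
  refine Finset.disjoint_left.2 fun k h h' => ?_
  have h1 := (Finset.mem_filter.1 h).2.1
  have h2 := (Finset.mem_filter.1 h').2.1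
  omega

/-- A 01 preceded by exactly r ones must end at the one numbered r+1 in the string, so its location
is determined by r. -/
lemma ups_subset_of_image {n : ℕ} {K K' : Finset ℕ} {y : Fin n → Fin 2}
    (h : (ups K y).image (ones y) ⊆ (ups K' y).image (ones y)) : ups K y ⊆ ups K' y := by
  intro k hk
  obtain ⟨k', hk', he⟩ := Finset.mem_image.1 (h (Finset.mem_image_of_mem _ hk))
  obtain ⟨-, h2, h3⟩ := Finset.mem_filter.1 hk
  obtain ⟨-, h2', h3'⟩ := Finset.mem_filter.1 hk'
  rcases lt_trichotomy k k' with hlt | heq | hlt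
  · exact absurd he (ones_lt_of_up h3 (Or.inl h2') hlt).ne'
  · exact heq ▸ hk'
  · exact absurd he (ones_lt_of_up h3' (Or.inl h2) hlt).ne

lemma downs_subset_of_image {n : ℕ} {K K' : Finset ℕ} {y : Fin n → Fin 2}
    (h : (downs K y).image (ones y) ⊆ (downs K' y).image (ones y)) : downs K y ⊆ downs K' y := by
  intro k hk
  obtain ⟨k', hk', he⟩ := Finset.mem_image.1 (h (Finset.mem_image_of_mem _ hk))
  have h2 := (Finset.mem_filter.1 hk).2.1
  have h2' := (Finset.mem_filter.1 hk').2.1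
  rcases lt_trichotomy k k' with hlt | heq | hlt
  · exact absurd he (ones_lt_of_down h2 hlt).ne'
  · exact heq ▸ hk'
  · exact absurd he (ones_lt_of_down h2' hlt).ne

/-- Strings of bounded weight with a common syndrome form a code. -/
lemma corrects_of_syndrome {n W t : ℕ} {b : ℕ → G} (hb : SignedInjective b W t)
    {C : Finset (Fin n → Fin 2)} {g : G} (hC : ∀ x ∈ C, ones x n ≤ W ∧ syndrome b x = g) :
    Corrects C t := by
  intro x hx x' hx' hne
  refine Set.eq_empty_iff_forall_notMem.2 fun y hy => hne ?_
  obtain ⟨K, hK, hcard, rfl⟩ := mem_outputs_iff.1 hy.1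
  obtain ⟨K', hK', hcard', he⟩ := mem_outputs_iff.1 hy.2
  set y := transpose K x with hydef
  -- Both codewords are now viewed as errors applied to the common output, so a single sequence of
  -- prefix counts indexes both corrections.
  have hx1 : transpose K y = x := hK.transpose_transpose x
  have hx2 : transpose K' y = x' := by rw [he, hK'.transpose_transpose]
  have hW : ones y n ≤ W := by rw [hydef, hK.ones_transpose_length]; exact (hC x hx).1
  have e1 := hK.syndrome_transpose b y
  have e2 := hK'.syndrome_transpose b y
  rw [hx1, (hC x hx).2] at e1
  rw [hx2, (hC x' hx').2] at e2
  have hdisj : ∀ {K : Finset ℕ}, IsPattern n K →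
      Disjoint ((ups K y).image (ones y)) ((downs K y).image (ones y)) := by
    intro K hK
    refine Finset.disjoint_left.2 fun r hr hr' => ?_
    obtain ⟨k, hk, rfl⟩ := Finset.mem_image.1 hr
    obtain ⟨k', hk', h⟩ := Finset.mem_image.1 hr'
    have := hK.ones_injOn y (by exact_mod_cast Finset.mem_union_right _ hk')
      (by exact_mod_cast Finset.mem_union_left _ hk) h
    exact Finset.disjoint_left.1 (disjoint_ups_downs K y) hk (this ▸ hk')
  have hle : ∀ {K : Finset ℕ}, K.card ≤ t →
      ((ups K y).image (ones y)).card + ((downs K y).image (ones y)).card ≤ t := by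
    intro K hK
    calc _ ≤ (ups K y).card + (downs K y).card :=
          Nat.add_le_add Finset.card_image_le Finset.card_image_le
      _ = (ups K y ∪ downs K y).card := (Finset.card_union_of_disjoint
          (disjoint_ups_downs K y)).symm
      _ ≤ K.card := Finset.card_le_card
          (Finset.union_subset (Finset.filter_subset _ _) (Finset.filter_subset _ _))
      _ ≤ t := hK
  obtain ⟨h1, h2⟩ := hb _ _ _ _
    (image_ones_subset hK hW Finset.subset_union_left)
    (image_ones_subset hK hW Finset.subset_union_right)
    (image_ones_subset hK' hW Finset.subset_union_left)
    (image_ones_subset hK' hW Finset.subset_union_right)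
    (hdisj hK) (hdisj hK') (hle hcard) (hle hcard') (add_left_cancel (e1.symm.trans e2))
  have hu : ups K y = ups K' y :=
    Finset.Subset.antisymm (ups_subset_of_image h1.subset) (ups_subset_of_image h1.symm.subset)
  have hd : downs K y = downs K' y :=
    Finset.Subset.antisymm (downs_subset_of_image h2.subset) (downs_subset_of_image h2.symm.subset)
  rw [← hx1, ← hx2, ← hK.transpose_ups_union_downs, ← hK'.transpose_ups_union_downs, hu, hd]

/-- Pigeonhole: the strings of weight at most `W` split into |G| syndrome classes, each of which is
empty or a code. -/
lemma card_ones_le_le_mul [Finite G] {W t : ℕ} {b : ℕ → G} (hb : SignedInjective b W t) (n : ℕ) :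
    ((Finset.univ : Finset (Fin n → Fin 2)).filter fun x => ones x n ≤ W).card ≤
      Nat.card G * maxCodeSize 2 n t := by
  classical
  have := Fintype.ofFinite G
  rw [Nat.card_eq_fintype_card, ← Finset.card_univ,
    Finset.card_eq_sum_card_fiberwise (f := syndrome b) (t := Finset.univ) (by simp),
    ← smul_eq_mul, ← Finset.sum_const]
  refine Finset.sum_le_sum fun g _ => ?_
  rcases Finset.eq_empty_or_nonempty
    (((Finset.univ : Finset (Fin n → Fin 2)).filter fun x => ones x n ≤ W).filter
      fun x => syndrome b x = g) with h | h
  · rw [h]; simp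
  · refine card_le_maxCodeSize h (corrects_of_syndrome (g := g) hb fun x hx => ?_)
    simpa using hx

end Syndrome

/-! ### Concentration of the binary weight -/

lemma pow_ones_length {n : ℕ} (x : Fin n → Fin 2) (z : ℝ) :
    z ^ ones x n = ∏ i, z ^ (x i : ℕ) := by
  rw [Finset.prod_pow_eq_pow_sum, ones, Finset.sum_range]
  simp [symbolAt]

/-- Few binary strings have substantially more ones than a random one. -/
lemma card_filter_lt_ones_le (n : ℕ) {s : ℝ} (hs : 0 < s) (hs1 : s ≤ 1) :
    (((Finset.univ : Finset (Fin n → Fin 2)).filter fun x =>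
      (1 + 2 * s) * n / 2 < (ones x n : ℝ)).card : ℝ) ≤
      2 ^ n * Real.exp (-(s ^ 2 / 2 * n)) := by
  classical
  set B := (Finset.univ : Finset (Fin n → Fin 2)).filter fun x =>
      (1 + 2 * s) * n / 2 < (ones x n : ℝ) with hB
  have hsum : ∑ x : Fin n → Fin 2, Real.exp s ^ ones x n = (1 + Real.exp s) ^ n := by
    simp_rw [pow_ones_length]
    have h := Finset.prod_univ_sum (fun _ : Fin n => (Finset.univ : Finset (Fin 2)))
      (fun _ a => Real.exp s ^ (a : ℕ))
    rw [Fintype.piFinset_univ] at h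
    rw [← h]
    simp
  have h1 : (B.card : ℝ) * Real.exp (s * ((1 + 2 * s) * n / 2)) ≤ (1 + Real.exp s) ^ n := by
    rw [← hsum, ← nsmul_eq_mul, ← Finset.sum_const]
    refine (Finset.sum_le_sum fun x hx => ?_).trans
      (Finset.sum_le_univ_sum_of_nonneg fun x => by positivity)
    rw [← Real.exp_nat_mul, Real.exp_le_exp]
    have := (Finset.mem_filter.1 hx).2
    nlinarith
  have h2 : 1 + Real.exp s ≤ 2 * Real.exp ((s + s ^ 2) / 2) := by
    have h3 := (abs_le.1 (Real.abs_exp_sub_one_sub_id_le (by rwa [abs_of_pos hs]))).2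
    have h4 := Real.add_one_le_exp ((s + s ^ 2) / 2)
    linarith
  have h5 : (1 + Real.exp s) ^ n ≤ 2 ^ n * Real.exp (n * ((s + s ^ 2) / 2)) := by
    rw [Real.exp_nat_mul, ← mul_pow]
    gcongr
  have h6 : 2 ^ n * Real.exp (-(s ^ 2 / 2 * n)) =
      2 ^ n * Real.exp (n * ((s + s ^ 2) / 2)) / Real.exp (s * ((1 + 2 * s) * n / 2)) := by
    rw [mul_div_assoc, ← Real.exp_sub]
    congr 2
    ring
  rw [h6, le_div_iff₀ (Real.exp_pos _)]
  exact h1.trans h5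

/-! ### Groups with distinct signed sums -/

/-- Sums of at most `t` of the elements `b 0, …, b (W - 1)`, with repetition, determine the
summands as soon as the number of summands is known. -/
def SumInjective {G : Type*} [AddCommGroup G] (b : ℕ → G) (W t : ℕ) : Prop :=
  ∀ M N : Multiset ℕ, (∀ j ∈ M, j < W) → (∀ j ∈ N, j < W) → M.card = N.card → M.card ≤ t →
    (M.map b).sum = (N.map b).sum → M = N

/-- Moving negative terms across turns the signed identity into an equality of sums over the
multisets A + B' and A' + B. These have equal size, and together at most 2t elements, hence at most
`t` each. Disjointness then rules out cancellation. -/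
lemma SumInjective.eq_of_card_sub_eq {G : Type*} [AddCommGroup G] {b : ℕ → G} {W t : ℕ}
    (hb : SumInjective b W t) {A B A' B' : Finset ℕ} (hA : A ⊆ Finset.range W)
    (hB : B ⊆ Finset.range W) (hA' : A' ⊆ Finset.range W) (hB' : B' ⊆ Finset.range W)
    (hAB : Disjoint A B) (hAB' : Disjoint A' B') (ht : A.card + B.card ≤ t)
    (ht' : A'.card + B'.card ≤ t)
    (hcard : (A.card : ℤ) - B.card = A'.card - B'.card)
    (hsum : ∑ j ∈ A, b j - ∑ j ∈ B, b j = ∑ j ∈ A', b j - ∑ j ∈ B', b j) :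
    A = A' ∧ B = B' := by
  have hmem : ∀ {S T : Finset ℕ}, S ⊆ Finset.range W → T ⊆ Finset.range W →
      ∀ j ∈ S.val + T.val, j < W := by
    intro S T hS hT j hj
    rcases Multiset.mem_add.1 hj with h | h
    · exact Finset.mem_range.1 (hS h)
    · exact Finset.mem_range.1 (hT h)
  have heq : A.val + B'.val = A'.val + B.val := by
    refine hb _ _ (hmem hA hB') (hmem hA' hB) ?_ ?_ ?_
    · simp only [Multiset.card_add, Finset.card_val]; omega
    · simp only [Multiset.card_add, Finset.card_val]; omega
    · simp only [Multiset.map_add, Multiset.sum_add]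
      exact sub_eq_sub_iff_add_eq_add.1 hsum
  have hcount : ∀ j, (if j ∈ A then 1 else 0) + (if j ∈ B' then 1 else 0) =
      (if j ∈ A' then 1 else 0) + (if j ∈ B then 1 else 0) := by
    intro j
    have := congrArg (Multiset.count j) heq
    simpa [Multiset.count_add, Multiset.count_eq_of_nodup, Finset.nodup] using this
  constructor
  · ext j
    have h1 := hcount j
    have h2 : j ∈ A → j ∉ B := fun h => Finset.disjoint_left.1 hAB h
    have h3 : j ∈ A' → j ∉ B' := fun h => Finset.disjoint_left.1 hAB' h
    by_cases a1 : j ∈ A <;> by_cases a2 : j ∈ B <;> by_cases a3 : j ∈ A' <;>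
      by_cases a4 : j ∈ B' <;> simp_all
  · ext j
    have h1 := hcount j
    have h2 : j ∈ A → j ∉ B := fun h => Finset.disjoint_left.1 hAB h
    have h3 : j ∈ A' → j ∉ B' := fun h => Finset.disjoint_left.1 hAB' h
    by_cases a1 : j ∈ A <;> by_cases a2 : j ∈ B <;> by_cases a3 : j ∈ A' <;>
      by_cases a4 : j ∈ B' <;> simp_all

lemma fst_sum_sub_sum {G : Type*} [AddCommGroup G] {m : ℕ} (b : ℕ → G) (A B : Finset ℕ) :
    (∑ j ∈ A, ((1 : ZMod m), b j) - ∑ j ∈ B, ((1 : ZMod m), b j)).1 =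
      (((A.card : ℤ) - B.card : ℤ) : ZMod m) := by
  simp [Prod.fst_sum]

lemma snd_sum_sub_sum {G : Type*} [AddCommGroup G] {m : ℕ} (b : ℕ → G) (A B : Finset ℕ) :
    (∑ j ∈ A, ((1 : ZMod m), b j) - ∑ j ∈ B, ((1 : ZMod m), b j)).2 =
      ∑ j ∈ A, b j - ∑ j ∈ B, b j := by
  simp [Prod.snd_sum]

/-- Counting modulo `2 t + 1` turns unsigned into signed sums. -/
lemma SumInjective.signedInjective {G : Type*} [AddCommGroup G] {b : ℕ → G} {W t : ℕ}
    (hb : SumInjective b W t) :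
    SignedInjective (fun j => ((1 : ZMod (2 * t + 1)), b j)) W t := by
  intro A B A' B' hA hB hA' hB' hAB hAB' ht ht' h
  refine hb.eq_of_card_sub_eq hA hB hA' hB' hAB hAB' ht ht' ?_ ?_
  · have h1 := congrArg Prod.fst h
    rw [fst_sum_sub_sum, fst_sum_sub_sum, ZMod.intCast_eq_intCast_iff_dvd_sub] at h1
    -- Both size differences lie in [-t, t], so they differ by at most 2t, less than the modulus.
    have h2 := Int.eq_zero_of_abs_lt_dvd h1 (by rw [abs_lt]; push_cast; constructor <;> omega)
    omega
  · have h1 := congrArg Prod.snd h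
    rwa [snd_sum_sub_sum, snd_sum_sub_sum] at h1

/-- The elements `θ + j` of a finite field are multiplicatively independent up to degree `t`. -/
lemma exists_sumInjective_units (p : ℕ) [Fact p.Prime] {t : ℕ} (ht : 2 ≤ t) :
    ∃ b : ℕ → Additive (GaloisField p t)ˣ, SumInjective b p t := by
  have hp := (Fact.out : p.Prime)
  obtain ⟨θ, hθ⟩ := Field.exists_primitive_element (ZMod p) (GaloisField p t)
  have hint : IsIntegral (ZMod p) θ := IsIntegral.of_finite _ _
  have hdeg : (minpoly (ZMod p) θ).natDegree = t := by
    rw [← IntermediateField.adjoin.finrank hint, hθ, IntermediateField.finrank_top',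
      GaloisField.finrank p (by omega)]
  have hzero : ∀ P : (ZMod p)[X], P.degree < t → aeval θ P = 0 → P = 0 := by
    intro P hP h0
    by_contra hne
    have h1 := minpoly.degree_le_of_ne_zero (ZMod p) θ hne h0
    rw [degree_eq_natDegree (minpoly.ne_zero hint), hdeg] at h1
    exact absurd hP (not_lt.2 h1)
  -- This is where t ≥ 2 enters: a generator of degree at least 2 is not a root of a linear
  -- polynomial over the prime field.
  have hne : ∀ j : ℕ, θ + j ≠ 0 := by
    intro j h
    have h1 := hzero (X + C (j : ZMod p)) (by
      rw [degree_X_add_C]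
      exact_mod_cast ht) (by simpa using h)
    exact X_add_C_ne_zero _ h1
  refine ⟨fun j => Additive.ofMul (Units.mk0 (θ + j) (hne j)), ?_⟩
  intro M N hM hN hcard hMt hsum
  have hprod : ∀ M : Multiset ℕ, ((Additive.toMul
      (M.map fun j : ℕ => Additive.ofMul (Units.mk0 (θ + (j : GaloisField p t)) (hne j))).sum :
        (GaloisField p t)ˣ) : GaloisField p t) =
      aeval θ (M.map fun j : ℕ => X - C (-(j : ZMod p))).prod := by
    intro M
    induction M using Multiset.induction_on with
    | empty => simp
    | cons j M ih =>
      simp only [Multiset.map_cons, Multiset.sum_cons, Multiset.prod_cons, map_mul, toMul_add,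
        Units.val_mul, ih]
      congr 1
      simp
  set P : Multiset ℕ → (ZMod p)[X] := fun M => (M.map fun j : ℕ => X - C (-(j : ZMod p))).prod
    with hP
  have hPeq : ∀ M, P M = ((M.map fun j : ℕ => -(j : ZMod p)).map fun a => X - C a).prod := by
    intro M; simp [hP, Multiset.map_map]
  have hmonic : ∀ M, (P M).Monic := fun M => by
    rw [hPeq]; exact monic_multiset_prod_of_monic _ _ fun a _ => monic_X_sub_C a
  have hPdeg : ∀ M, (P M).degree = M.card := fun M => by
    rw [degree_eq_natDegree (hmonic M).ne_zero, hPeq, natDegree_multiset_prod_X_sub_C_eq_card]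
    simp
  have hroots : ∀ M, (P M).roots = M.map fun j : ℕ => -(j : ZMod p) := fun M => by
    rw [hPeq, roots_multiset_prod_X_sub_C]
  have haeval : aeval θ (P M - P N) = 0 := by
    rw [map_sub, ← hprod, ← hprod, hsum, sub_self]
  -- Two monic polynomials of equal degree at most t differ by one of degree below t, which cannot
  -- vanish at `θ` unless it is zero. The roots then recover the multiset.
  have hPP : P M = P N := by
    rcases Nat.eq_zero_or_pos M.card with h0 | hpos
    · rw [Multiset.card_eq_zero.1 h0, Multiset.card_eq_zero.1 (show N.card = 0 by omega)]
    · refine sub_eq_zero.1 (hzero _ ?_ haeval)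
      refine lt_of_lt_of_le (degree_sub_lt_left ?_ (hmonic M).ne_zero ?_) ?_
      · rw [hPdeg, hPdeg, hcard]
      · rw [(hmonic M).leadingCoeff, (hmonic N).leadingCoeff]
      · rw [hPdeg]; exact_mod_cast hMt
  have hinv : ∀ M : Multiset ℕ, (∀ j ∈ M, j < p) →
      (M.map fun j : ℕ => -(j : ZMod p)).map (fun a => (-a).val) = M := by
    intro M hM
    rw [Multiset.map_map]
    conv_rhs => rw [← Multiset.map_id M]
    refine Multiset.map_congr rfl fun j hj => ?_
    simp [ZMod.val_natCast_of_lt (hM j hj)]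
  rw [← hinv M hM, ← hinv N hN, ← hroots, ← hroots, hPP]

/-- A signed sum of at most one term is an integer `e` in [-W, W], and these 2W+1 integers are
distinct modulo 2W+1. -/
lemma signedInjective_one (W : ℕ) :
    SignedInjective (fun j : ℕ => ((j + 1 : ℕ) : ZMod (2 * W + 1))) W 1 := by
  intro A B A' B' hA hB hA' hB' hAB hAB' ht ht' h
  have hval : ∀ {A B : Finset ℕ}, A ⊆ Finset.range W → B ⊆ Finset.range W →
      A.card + B.card ≤ 1 → ∃ e : ℤ, |e| ≤ W ∧
      ∑ j ∈ A, ((j + 1 : ℕ) : ZMod (2 * W + 1)) - ∑ j ∈ B, ((j + 1 : ℕ) : ZMod (2 * W + 1)) = e ∧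
      (A = if 0 < e then {e.toNat - 1} else ∅) ∧ (B = if e < 0 then {(-e).toNat - 1} else ∅) := by
    intro A B hA hB hc
    rcases Nat.eq_zero_or_pos A.card with h0 | h0
    · rcases Nat.eq_zero_or_pos B.card with h1 | h1
      · rw [Finset.card_eq_zero] at h0 h1
        exact ⟨0, by simp, by simp [h0, h1], by simp [h0], by simp [h1]⟩
      · obtain ⟨j, rfl⟩ := Finset.card_eq_one.1 (show B.card = 1 by omega)
        rw [Finset.card_eq_zero] at h0
        have hj := Finset.mem_range.1 (hB (Finset.mem_singleton_self j))
        refine ⟨-(j + 1 : ℕ), by rw [abs_le]; omega, by simp [h0], ?_, ?_⟩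
        · rw [h0, if_neg (by omega)]
        · rw [if_pos (by omega)]; congr 1
    · obtain ⟨j, rfl⟩ := Finset.card_eq_one.1 (show A.card = 1 by omega)
      have h1 : B = ∅ := Finset.card_eq_zero.1 (by omega)
      have hj := Finset.mem_range.1 (hA (Finset.mem_singleton_self j))
      refine ⟨(j + 1 : ℕ), by rw [abs_le]; omega, by simp [h1], ?_, ?_⟩
      · rw [if_pos (by omega)]; congr 1
      · rw [h1, if_neg (by omega)]
  obtain ⟨e, he, hs, e1, e2⟩ := hval hA hB ht
  obtain ⟨e', he', hs', e1', e2'⟩ := hval hA' hB' ht'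
  rw [hs, hs', ZMod.intCast_eq_intCast_iff_dvd_sub] at h
  rw [abs_le] at he he'
  have h2 := Int.eq_zero_of_abs_lt_dvd h (by rw [abs_lt]; push_cast; constructor <;> omega)
  obtain rfl : e = e' := by omega
  exact ⟨e1.trans e1'.symm, e2.trans e2'.symm⟩

/-- Eliminating x gives y² + yz + z² = 0, so if z ≠ 0 then u = y/z satisfies u² + u + 1 = 0 and u³ =
1. As 3 does not divide p - 1, this forces u = 1 and 3 = 0, a contradiction. -/
lemma eq_zero_of_sum_sq_eq_zero {p : ℕ} [Fact p.Prime] (hp3 : p % 3 = 2) (hp2 : p ≠ 2)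
    {x y z : ZMod p} (h1 : x + y + z = 0) (h2 : x ^ 2 + y ^ 2 + z ^ 2 = 0) : z = 0 := by
  have hp := (Fact.out : p.Prime)
  have h2ne : (2 : ZMod p) ≠ 0 := by
    have : ((2 : ℕ) : ZMod p) ≠ 0 := by
      rw [Ne, ZMod.natCast_eq_zero_iff]
      exact fun h => hp2 ((Nat.prime_dvd_prime_iff_eq hp Nat.prime_two).1 h)
    exact_mod_cast this
  have h3ne : (3 : ZMod p) ≠ 0 := by
    have : ((3 : ℕ) : ZMod p) ≠ 0 := by
      rw [Ne, ZMod.natCast_eq_zero_iff]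
      intro h
      have := (Nat.prime_dvd_prime_iff_eq hp Nat.prime_three).1 h
      omega
    exact_mod_cast this
  by_contra hz
  have hx : x = -(y + z) := by linear_combination h1
  have hq : y ^ 2 + y * z + z ^ 2 = 0 := by
    have : 2 * (y ^ 2 + y * z + z ^ 2) = 0 := by rw [hx] at h2; linear_combination h2
    exact (mul_eq_zero.1 this).resolve_left h2ne
  set u := y / z with hu
  have hyu : y = u * z := by rw [hu]; field_simp
  have hu2 : u ^ 2 + u + 1 = 0 := by
    have : (u ^ 2 + u + 1) * z ^ 2 = 0 := by rw [hyu] at hq; linear_combination hq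
    exact (mul_eq_zero.1 this).resolve_right (pow_ne_zero _ hz)
  have hu3 : u ^ 3 = 1 := by linear_combination (u - 1) * hu2
  have hu0 : u ≠ 0 := by rintro h; simp [h] at hu2
  have hup := ZMod.pow_card_sub_one_eq_one hu0
  have hu1 : u = 1 := by
    have hg : u ^ Nat.gcd 3 (p - 1) = 1 := by rw [pow_gcd_eq_one]; exact ⟨hu3, hup⟩
    have hco : Nat.gcd 3 (p - 1) = 1 := by
      refine (Nat.Prime.coprime_iff_not_dvd Nat.prime_three).2 ?_
      have := hp.two_le
      omega
    rwa [hco, pow_one] at hg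
  rw [hu1] at hu2
  exact h3ne (by linear_combination hu2)

lemma natCast_injOn_lt {p a b : ℕ} (ha : a < p) (hb : b < p) (h : (a : ZMod p) = b) : a = b := by
  rw [ZMod.natCast_eq_natCast_iff', Nat.mod_eq_of_lt ha, Nat.mod_eq_of_lt hb] at h
  exact h

/-- Sum and sum of squares determine an unordered pair in odd characteristic: eliminating b leaves
2(a - c)(a - d) = 0. -/
lemma sumInjective_sq {p : ℕ} [Fact p.Prime] (hp2 : p ≠ 2) :
    SumInjective (fun j : ℕ => ((j : ZMod p), (j : ZMod p) ^ 2)) p 2 := by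
  have hp := (Fact.out : p.Prime)
  have h2ne : (2 : ZMod p) ≠ 0 := by
    have : ((2 : ℕ) : ZMod p) ≠ 0 := by
      rw [Ne, ZMod.natCast_eq_zero_iff]
      exact fun h => hp2 ((Nat.prime_dvd_prime_iff_eq hp Nat.prime_two).1 h)
    exact_mod_cast this
  intro M N hM hN hcard hMt hsum
  have hM3 : M.card = 0 ∨ M.card = 1 ∨ M.card = 2 := by omega
  rcases hM3 with h | h | h
  · rw [Multiset.card_eq_zero.1 h, Multiset.card_eq_zero.1 (show N.card = 0 by omega)]
  · obtain ⟨a, rfl⟩ := Multiset.card_eq_one.1 h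
    obtain ⟨b, rfl⟩ := Multiset.card_eq_one.1 (hcard ▸ h)
    simp only [Multiset.map_singleton, Multiset.sum_singleton, Prod.mk.injEq] at hsum
    rw [natCast_injOn_lt (hM a (by simp)) (hN b (by simp)) hsum.1]
  · obtain ⟨a, b, rfl⟩ := Multiset.card_eq_two.1 h
    obtain ⟨c, d, rfl⟩ := Multiset.card_eq_two.1 (hcard ▸ h)
    simp only [Multiset.insert_eq_cons, Multiset.map_cons, Multiset.map_singleton,
      Multiset.sum_cons, Multiset.sum_singleton, Prod.mk_add_mk, Prod.mk.injEq] at hsum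
    obtain ⟨h1, h2⟩ := hsum
    have ha := hM a (by simp)
    have hb := hM b (by simp)
    have hc := hN c (by simp)
    have hd := hN d (by simp)
    have h3 : ((a : ZMod p) - c) * (a - d) = 0 := by
      have : 2 * (((a : ZMod p) - c) * (a - d)) = 0 := by
        have hb' : (b : ZMod p) = c + d - a := by linear_combination h1
        rw [hb'] at h2
        linear_combination h2
      exact (mul_eq_zero.1 this).resolve_left h2ne
    rcases mul_eq_zero.1 h3 with h4 | h4
    · have h5 := natCast_injOn_lt ha hc (sub_eq_zero.1 h4)
      have h6 := natCast_injOn_lt hb hd (by linear_combination h1 - h4)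
      rw [h5, h6]
    · have h5 := natCast_injOn_lt ha hd (sub_eq_zero.1 h4)
      have h6 := natCast_injOn_lt hb hc (by linear_combination h1 - h4)
      rw [h5, h6]
      exact Multiset.pair_comm _ _

/-- The identity a = -(b + c), together with its analogue for squares, forces b = c = 0 modulo p,
contrary to b ≠ c. -/
lemma no_single_eq_neg_pair {p : ℕ} [Fact p.Prime] (hp3 : p % 3 = 2) (hp2 : p ≠ 2)
    {A B A' B' : Finset ℕ} (hA' : A' ⊆ Finset.range p) (hB' : B' ⊆ Finset.range p)
    (hA : A.card = 1) (hB : B.card = 0) (hAB' : A'.card = 0 ∧ B'.card = 2)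
    (h : ∑ j ∈ A, ((j : ZMod p), (j : ZMod p) ^ 2) - ∑ j ∈ B, ((j : ZMod p), (j : ZMod p) ^ 2) =
      ∑ j ∈ A', ((j : ZMod p), (j : ZMod p) ^ 2) - ∑ j ∈ B', ((j : ZMod p), (j : ZMod p) ^ 2)) :
    False := by
  obtain ⟨a, rfl⟩ := Finset.card_eq_one.1 hA
  obtain rfl := Finset.card_eq_zero.1 hB
  obtain rfl := Finset.card_eq_zero.1 hAB'.1
  obtain ⟨b, c, hbc, rfl⟩ := Finset.card_eq_two.1 hAB'.2
  rw [Finset.sum_pair hbc] at h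
  simp only [Finset.sum_singleton, Finset.sum_empty, sub_zero, zero_sub, Prod.mk_add_mk,
    Prod.neg_mk, Prod.mk.injEq] at h
  obtain ⟨h1, h2⟩ := h
  have hc := eq_zero_of_sum_sq_eq_zero hp3 hp2 (x := (a : ZMod p)) (y := b) (z := c)
    (by linear_combination h1) (by linear_combination h2)
  have hb := eq_zero_of_sum_sq_eq_zero hp3 hp2 (x := (a : ZMod p)) (y := c) (z := b)
    (by linear_combination h1) (by linear_combination h2)
  exact hbc (natCast_injOn_lt (Finset.mem_range.1 (hB' (by simp)))
    (Finset.mem_range.1 (hB' (by simp))) (hb.trans hc.symm))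

/-- Two errors only need counting modulo `3`. -/
lemma signedInjective_two {p : ℕ} [Fact p.Prime] (hp3 : p % 3 = 2) (hp2 : p ≠ 2) :
    SignedInjective (fun j : ℕ => ((1 : ZMod 3), ((j : ZMod p), (j : ZMod p) ^ 2))) p 2 := by
  intro A B A' B' hA hB hA' hB' hAB hAB' ht ht' h
  have h1 := congrArg Prod.fst h
  have h2 := congrArg Prod.snd h
  rw [fst_sum_sub_sum, fst_sum_sub_sum, ZMod.intCast_eq_intCast_iff_dvd_sub] at h1
  rw [snd_sum_sub_sum, snd_sum_sub_sum] at h2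
  by_cases hd : (A.card : ℤ) - B.card = A'.card - B'.card
  · exact (sumInjective_sq hp2).eq_of_card_sub_eq hA hB hA' hB' hAB hAB' ht ht' hd h2
  · exfalso
    have h2n : ∑ j ∈ B, ((j : ZMod p), (j : ZMod p) ^ 2) - ∑ j ∈ A, ((j : ZMod p), (j : ZMod p) ^ 2)
        = ∑ j ∈ B', ((j : ZMod p), (j : ZMod p) ^ 2) -
          ∑ j ∈ A', ((j : ZMod p), (j : ZMod p) ^ 2) := by
      rw [← neg_sub, h2, neg_sub]
    obtain ⟨k, hk⟩ := h1
    -- Distinct size differences in [-2, 2] that agree modulo 3 are 1 and -2, or 2 and -1. Each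
    -- occurs only as a single term against a pair of opposite sign.
    have hcases : (A.card = 1 ∧ B.card = 0 ∧ A'.card = 0 ∧ B'.card = 2) ∨
        (A.card = 0 ∧ B.card = 1 ∧ A'.card = 2 ∧ B'.card = 0) ∨
        (A.card = 2 ∧ B.card = 0 ∧ A'.card = 0 ∧ B'.card = 1) ∨
        (A.card = 0 ∧ B.card = 2 ∧ A'.card = 1 ∧ B'.card = 0) := by omega
    rcases hcases with ⟨c1, c2, c3⟩ | ⟨c1, c2, c3, c4⟩ | ⟨c1, c2, c3, c4⟩ | ⟨c1, c2, c3, c4⟩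
    · exact no_single_eq_neg_pair hp3 hp2 hA' hB' c1 c2 c3 h2
    · exact no_single_eq_neg_pair hp3 hp2 hB' hA' c2 c1 ⟨c4, c3⟩ h2n
    · exact no_single_eq_neg_pair hp3 hp2 hB hA c4 c3 ⟨c2, c1⟩ h2n.symm
    · exact no_single_eq_neg_pair hp3 hp2 hA hB c3 c4 ⟨c1, c2⟩ h2.symm

/-! ### Assembling the binary lower bound -/

/-- The size of a code from a signed-injective sequence, in terms of `binaryConst`. -/
lemma card_ones_le_prime_le {p : ℕ} (hp : p.Prime) (hp3 : p % 3 = 2) (hp2 : p ≠ 2) {t : ℕ}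
    (ht : 1 ≤ t) (n : ℕ) :
    (((Finset.univ : Finset (Fin n → Fin 2)).filter fun x => ones x n ≤ p).card : ℝ) ≤
      ((binaryConst t)⁻¹ * (p : ℝ) ^ t + 1) * maxCodeSize 2 n t := by
  have : Fact p.Prime := ⟨hp⟩
  have of_group : ∀ {G : Type} [AddCommGroup G] [Finite G] (b : ℕ → G), SignedInjective b p t →
      (Nat.card G : ℝ) ≤ (binaryConst t)⁻¹ * (p : ℝ) ^ t + 1 →
      (((Finset.univ : Finset (Fin n → Fin 2)).filter fun x => ones x n ≤ p).card : ℝ) ≤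
      ((binaryConst t)⁻¹ * (p : ℝ) ^ t + 1) * maxCodeSize 2 n t := by
    intro G _ _ b hb hG
    have h1 : (((Finset.univ : Finset (Fin n → Fin 2)).filter fun x => ones x n ≤ p).card : ℝ) ≤
        Nat.card G * maxCodeSize 2 n t := by exact_mod_cast card_ones_le_le_mul hb n
    exact h1.trans (by gcongr)
  rcases Nat.lt_or_ge t 3 with h3 | h3
  · have ht12 : t = 1 ∨ t = 2 := by omega
    rcases ht12 with rfl | rfl
    · refine of_group _ (signedInjective_one p) ?_
      simp [binaryConst]
    · refine of_group _ (signedInjective_two hp3 hp2) ?_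
      simp only [Nat.card_prod, Nat.card_zmod, binaryConst]
      push_cast
      norm_num
      nlinarith
  · obtain ⟨b, hb⟩ := exists_sumInjective_units p (by omega : 2 ≤ t)
    have : Finite (GaloisField p t) := inferInstance
    refine of_group _ hb.signedInjective ?_
    have hcard : Nat.card (Additive (GaloisField p t)ˣ) ≤ p ^ t := by
      rw [← GaloisField.card p t (by omega)]
      exact Nat.card_le_card_of_injective (fun u : Additive (GaloisField p t)ˣ =>
        ((Additive.toMul u : (GaloisField p t)ˣ) : GaloisField p t))
        (Units.val_injective.comp Additive.toMul.injective)
    have hcard' : (Nat.card (Additive (GaloisField p t)ˣ) : ℝ) ≤ (p : ℝ) ^ t := by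
      exact_mod_cast hcard
    have hc : (binaryConst t)⁻¹ = 2 * t + 1 := by
      rw [binaryConst, if_neg (by omega), if_neg (by omega), one_div, inv_inv]
    rw [hc, Nat.card_prod, Nat.card_zmod]
    push_cast
    have : (0 : ℝ) ≤ 2 * t + 1 := by positivity
    nlinarith

lemma binaryConst_pos (t : ℕ) : 0 < binaryConst t := by
  unfold binaryConst
  split_ifs <;> positivity

theorem asympLE_binary {t : ℕ} (ht : 1 ≤ t) :
    AsympLE (fun n => binaryConst t * ((2 : ℝ) ^ (n + t) / (n : ℝ) ^ t))
      (fun n => (maxCodeSize 2 n t : ℝ)) := by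
  classical
  refine asympLE_of_forall_eventually
    (Eventually.of_forall fun n => by exact_mod_cast maxCodeSize_pos (by norm_num) n t)
    fun η hη => ?_
  set c := binaryConst t with hc
  have hc0 : 0 < c := binaryConst_pos t
  -- The factor 1+2s is the weight cutoff relative to n/2, and 1+s is the gap from that cutoff up to
  -- the next suitable prime.
  obtain ⟨s, hs0, hs1, hsη⟩ : ∃ s : ℝ, 0 < s ∧ s ≤ 1 ∧
      ((1 + s) * (1 + 2 * s)) ^ t ≤ 1 + η / 4 := by
    have hcont : ContinuousAt (fun s : ℝ => ((1 + s) * (1 + 2 * s)) ^ t) 0 := by fun_prop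
    have h1 : ∀ᶠ s : ℝ in 𝓝 0, ((1 + s) * (1 + 2 * s)) ^ t < 1 + η / 4 :=
      hcont.eventually_lt_const (by simp; linarith)
    have h2 : ∀ᶠ s : ℝ in 𝓝[>] 0, ((1 + s) * (1 + 2 * s)) ^ t < 1 + η / 4 :=
      h1.filter_mono nhdsWithin_le_nhds
    obtain ⟨s, h3, h4⟩ := (h2.and (Ioc_mem_nhdsGT zero_lt_one)).exists
    exact ⟨s, h4.1, h4.2, h3.le⟩
  have hx : Tendsto (fun n : ℕ => (1 + 2 * s) * n / 2) atTop atTop := by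
    have := (tendsto_natCast_atTop_atTop (R := ℝ)).const_mul_atTop
      (show 0 < (1 + 2 * s) / 2 by linarith)
    refine this.congr fun n => by ring
  have hprime := hx.eventually (PrimeGap.eventually_exists_prime_mod_three hs0)
  have hx3 := hx.eventually_ge_atTop 3
  have htail : ∀ᶠ n : ℕ in atTop, (n : ℝ) ^ 0 * Real.exp (0 - s ^ 2 / 2 * n) <
      η / 2 / (1 + η) :=
    (tendsto_pow_mul_exp_neg (by positivity) 0 0).eventually_lt_const (by positivity)
  have hY : ∀ᶠ n : ℕ in atTop, 4 * c / η ≤ ((n : ℝ) / 2) ^ t := by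
    have h1 : Tendsto (fun n : ℕ => ((n : ℝ) / 2) ^ t) atTop atTop :=
      (tendsto_pow_atTop (by omega : t ≠ 0)).comp
        ((tendsto_natCast_atTop_atTop (R := ℝ)).atTop_div_const (by norm_num))
    exact h1.eventually_ge_atTop _
  filter_upwards [hprime, hx3, htail, hY, eventually_ge_atTop 1] with n h1 h2 h3 h4 hn
  obtain ⟨p, hp, hp3, hxp, hpx⟩ := h1
  have hn0 : (0 : ℝ) < n := by exact_mod_cast hn
  have hp2 : p ≠ 2 := by
    rintro rfl
    norm_num at hxp
    linarith
  set e := Real.exp (-(s ^ 2 / 2 * n)) with he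
  have he0 : 0 < e := Real.exp_pos _
  rw [pow_zero, one_mul, zero_sub, ← he, lt_div_iff₀ (by linarith)] at h3
  have hcount : (2 : ℝ) ^ n * (1 - e) ≤
      ((Finset.univ : Finset (Fin n → Fin 2)).filter fun x => ones x n ≤ p).card := by
    have hB := card_filter_lt_ones_le n hs0 hs1
    have hsplit := Finset.card_filter_add_card_filter_not (s := (Finset.univ :
      Finset (Fin n → Fin 2))) (fun x => (1 + 2 * s) * n / 2 < (ones x n : ℝ))
    simp only [Finset.card_univ, Fintype.card_pi, Fintype.card_fin, Finset.prod_const] at hsplit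
    have hle : ((Finset.univ : Finset (Fin n → Fin 2)).filter
        fun x => ¬ (1 + 2 * s) * n / 2 < (ones x n : ℝ)).card ≤
        ((Finset.univ : Finset (Fin n → Fin 2)).filter fun x => ones x n ≤ p).card := by
      refine Finset.card_le_card fun x hx => ?_
      have hx' := not_lt.1 (Finset.mem_filter.1 hx).2
      exact Finset.mem_filter.2 ⟨Finset.mem_univ _, by exact_mod_cast hx'.trans hxp⟩
    have hsplit' : (((Finset.univ : Finset (Fin n → Fin 2)).filter
        fun x => (1 + 2 * s) * n / 2 < (ones x n : ℝ)).card : ℝ) +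
        (((Finset.univ : Finset (Fin n → Fin 2)).filter
        fun x => ¬ (1 + 2 * s) * n / 2 < (ones x n : ℝ)).card : ℝ) = 2 ^ n := by
      exact_mod_cast hsplit
    have hle' : (((Finset.univ : Finset (Fin n → Fin 2)).filter
        fun x => ¬ (1 + 2 * s) * n / 2 < (ones x n : ℝ)).card : ℝ) ≤
        ((Finset.univ : Finset (Fin n → Fin 2)).filter fun x => ones x n ≤ p).card := by
      exact_mod_cast hle
    linarith
  have hcode := hcount.trans (card_ones_le_prime_le hp hp3 hp2 ht n)
  rw [← hc] at hcode
  set M : ℝ := (maxCodeSize 2 n t : ℝ) with hM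
  have hM0 : 0 ≤ M := Nat.cast_nonneg _
  set Y : ℝ := ((n : ℝ) / 2) ^ t with hYdef
  have hY0 : 0 < Y := by positivity
  have hpt : (p : ℝ) ^ t ≤ (1 + η / 4) * Y := by
    calc (p : ℝ) ^ t ≤ ((1 + s) * ((1 + 2 * s) * n / 2)) ^ t := by gcongr
      _ = ((1 + s) * (1 + 2 * s)) ^ t * Y := by rw [hYdef, ← mul_pow]; congr 1; ring
      _ ≤ _ := by gcongr
  -- The error budget: η/4 from p^t, η/4 from the additive 1 in the bound for the group order, and
  -- the remaining η/2 from discarding heavy strings.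
  have h5 : c⁻¹ * (p : ℝ) ^ t + 1 ≤ c⁻¹ * Y * ((1 + η) * (1 - e)) := by
    have h6 : c ≤ η / 4 * Y := by
      rw [div_le_iff₀ hη] at h4
      linarith
    have h7 : (p : ℝ) ^ t + c ≤ Y * ((1 + η) * (1 - e)) := by nlinarith
    calc c⁻¹ * (p : ℝ) ^ t + 1 = c⁻¹ * ((p : ℝ) ^ t + c) := by
          rw [mul_add, inv_mul_cancel₀ hc0.ne']
      _ ≤ c⁻¹ * (Y * ((1 + η) * (1 - e))) := by gcongr
      _ = _ := by ring
  have he1 : 0 < 1 - e := by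
    have : e * (1 + η) < 1 + η := by linarith
    nlinarith
  have h8 : (2 : ℝ) ^ n ≤ c⁻¹ * Y * ((1 + η) * M) := by
    have := hcode.trans (mul_le_mul_of_nonneg_right h5 hM0)
    refine le_of_mul_le_mul_right ?_ he1
    linarith
  have h9 : c * ((2 : ℝ) ^ (n + t) / (n : ℝ) ^ t) = c * Y⁻¹ * 2 ^ n := by
    rw [hYdef, div_pow, inv_div, pow_add]
    ring
  rw [h9]
  calc c * Y⁻¹ * 2 ^ n ≤ c * Y⁻¹ * (c⁻¹ * Y * ((1 + η) * M)) := by gcongr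
    _ = (1 + η) * M := by field_simp

end TranspositionCodes

theorem mainTheorem4 (q t : ℕ) (hq : 2 ≤ q) (ht : 1 ≤ t) :
    TranspositionCodes.AsympLE
      (fun n => ((2 * t).factorial : ℝ) * (q : ℝ) ^ n /
        ((4 * (t : ℝ) / 3 + 1) * (n : ℝ) ^ (2 * t)))
      (fun n => (TranspositionCodes.maxCodeSize q n t : ℝ)) ∧
    TranspositionCodes.AsympLE
      (fun n => (TranspositionCodes.maxCodeSize q n t : ℝ))
      (fun n => (t.factorial : ℝ) * (q : ℝ) ^ (n + t) /
        (((q : ℝ) - 1) ^ t * (n : ℝ) ^ t)) ∧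
    (q = 2 →
      TranspositionCodes.AsympLE
        (fun n => TranspositionCodes.binaryConst t * ((2 : ℝ) ^ (n + t) / (n : ℝ) ^ t))
        (fun n => (TranspositionCodes.maxCodeSize q n t : ℝ))) := by
  refine ⟨TranspositionCodes.asympLE_gilbertVarshamov hq ht,
    TranspositionCodes.asympLE_packing hq, ?_⟩
  rintro rfl
  exact TranspositionCodes.asympLE_binary ht
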